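/- Let $\mathbb K$ be the field of convergent Puiseux series over $\mathbb C$, i.e. of series $b(t)=\sum_{\tau\in R}c_\tau t^\tau$ with $c_\tau\in\mathbb C$, where $R\subset\mathbb R$ is contained in a (Minkowski) sum of finitely many arithmetic progressions that are bounded from below, and $\sum_{\tau\in R}|c_\tau|t^\tau<\infty$ for all sufficiently small $t>0$. For $b\ne 0$ put $\operatorname{Val}(b)=-\min\{\tau : c_\tau\neq 0\}$. For a finite set $I\subset\mathbb Z^k$ and a Laurent polynomial $f(z)=\sum_{\omega\in I}c_\omega z^\omega$ with all $c_\omega\in\mathbb K^*$, the non-Archimedean amoeba of $f$ is $$A_f=\{(\operatorname{Val}(z_1),\dots,\operatorname{Val}(z_k)) : z\in(\mathbb K^*)^k,\ f(z)=0\}\subset\mathbb R^k,$$ and $\mathcal A(I)$ denotes the set of all such subsets $A_f$ of $\mathbb R^k$. Theorem. Let $k\ge 2$ and $n\ge 1$ be integers and let $I\subset\mathbb Z^k$ be a set of exactly $n+1$ points. Then for a generic $n$-tuple $(x_1,\dots,x_n)\in(\mathbb R^k)^n$ there exists one and only one amoeba $A\in\mathcal A(I)$ with $x_1,\dots,x_n\in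 A$. Here "generic" means: outside the union of finitely many linear hyperplanes of $(\mathbb R^k)^n$ that depend only on $k,n,I$. The same holds, for the same generic $n$-tuples, if $\mathbb K$ is replaced by any algebraically closed field $K$ with a non-Archimedean valuation $\operatorname{Val}:K^*\to\mathbb R$ that is onto $\mathbb R$ (with $\operatorname{Val}(ab)=\operatorname{Val}(a)+\operatorname{Val}(b)$ and $\operatorname{Val}(a+b)\le\max\{\operatorname{Val}(a),\operatorname{Val}(b)\}$). -/

import Mathlib

open Filter Topology
open scoped WithZero

noncomputable section

namespace ConvPuiseux

/-! ### Convergent Puiseux series with real exponents -/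

/-- `S` lies in a sum `(a₁ + ℕ d₁) + ⋯ + (a_N + ℕ d_N)` of finitely many arithmetic progressions
that are bounded from below. -/
def InSumOfProgressions (S : Set ℝ) : Prop :=
  ∃ (N : ℕ) (a d : Fin N → ℝ), (∀ i, 0 < d i) ∧
    ∀ τ ∈ S, ∃ m : Fin N → ℕ, τ = ∑ i, (a i + (m i : ℝ) * d i)

/-- The formal series `b = ∑ c_τ t ^ τ` with complex coefficients and real exponents is a convergent
Puiseux series: its exponents lie in a sum of finitely many arithmetic progressions bounded from
below, and `∑ |c_τ| t ^ τ < ∞` for all sufficiently small `t > 0`. -/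
def IsConvergent (b : HahnSeries ℝ ℂ) : Prop :=
  InSumOfProgressions b.support ∧
    ∀ᶠ t : ℝ in 𝓝[>] 0, Summable fun τ : ℝ => ‖b.coeff τ‖ * t ^ τ

/-! The following facts serve to show that these series form a field. -/

theorem inSum_iff (S : Set ℝ) : InSumOfProgressions S ↔
    ∃ (a : ℝ) (D : Finset ℝ), (∀ d ∈ D, 0 < d) ∧
      ∀ τ ∈ S, τ - a ∈ AddSubmonoid.closure (D : Set ℝ) := by
  classical
  constructor
  · rintro ⟨N, a, d, hd, h⟩
    refine ⟨∑ i, a i, Finset.univ.image d, ?_, ?_⟩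
    · intro x hx
      simp only [Finset.mem_image, Finset.mem_univ, true_and] at hx
      obtain ⟨i, rfl⟩ := hx
      exact hd i
    · intro τ hτ
      obtain ⟨m, rfl⟩ := h τ hτ
      rw [Finset.sum_add_distrib, add_sub_cancel_left]
      refine AddSubmonoid.sum_mem _ fun i _ => ?_
      rw [← nsmul_eq_mul]
      exact AddSubmonoid.nsmul_mem _ (AddSubmonoid.subset_closure (by simp)) _
  · rintro ⟨a, D, hD, h⟩
    refine ⟨D.card + 1, Fin.cons a (fun _ => 0), Fin.cons 1 (fun i => (D.equivFin.symm i : ℝ)),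
      ?_, ?_⟩
    · intro i
      refine Fin.cases ?_ ?_ i
      · simp
      · intro j
        simpa using hD _ (D.equivFin.symm j).2
    · intro τ hτ
      obtain ⟨f, -, hf⟩ := AddSubmonoid.mem_closure_finset.1 (h τ hτ)
      refine ⟨Fin.cons 0 (fun i => f (D.equivFin.symm i : ℝ)), ?_⟩
      have h2 : ∑ i, ((f (D.equivFin.symm i : ℝ) : ℝ) * (D.equivFin.symm i : ℝ))
          = ∑ x ∈ D, f x • x := by
        rw [← Finset.sum_coe_sort D]
        simp only [nsmul_eq_mul]
        exact Equiv.sum_comp D.equivFin.symm (fun x : D => (f (x : ℝ) : ℝ) * (x : ℝ))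
      rw [Fin.sum_univ_succ]
      simp only [Fin.cons_zero, Fin.cons_succ, zero_add, Nat.cast_zero, zero_mul, add_zero]
      rw [h2, hf]
      ring

theorem inSum_mono {S S' : Set ℝ} (h : S ⊆ S') (h' : InSumOfProgressions S') :
    InSumOfProgressions S := by
  obtain ⟨N, a, d, hd, H⟩ := h'
  exact ⟨N, a, d, hd, fun τ hτ => H τ (h hτ)⟩

theorem inSum_singleton (a : ℝ) : InSumOfProgressions {a} := by
  rw [inSum_iff]
  exact ⟨a, ∅, by simp, by simp⟩

theorem inSum_union {S S' : Set ℝ} (h : InSumOfProgressions S) (h' : InSumOfProgressions S') :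
    InSumOfProgressions (S ∪ S') := by
  classical
  rw [inSum_iff] at *
  obtain ⟨a, D, hD, H⟩ := h
  obtain ⟨a', D', hD', H'⟩ := h'
  set E : Finset ℝ := D ∪ D' ∪ ({a - min a a', a' - min a a'} : Finset ℝ).filter (0 < ·) with hE
  have key : ∀ x ∈ ({a - min a a', a' - min a a'} : Finset ℝ),
      x ∈ AddSubmonoid.closure (E : Set ℝ) := by
    intro x hx
    have h0 : 0 ≤ x := by
      simp only [Finset.mem_insert, Finset.mem_singleton] at hx
      rcases hx with rfl | rfl
      · linarith [min_le_left a a']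
      · linarith [min_le_right a a']
    rcases h0.eq_or_lt with h0 | h0
    · rw [← h0]
      exact AddSubmonoid.zero_mem _
    · refine AddSubmonoid.subset_closure ?_
      rw [hE, Finset.mem_coe, Finset.mem_union, Finset.mem_filter]
      exact Or.inr ⟨hx, h0⟩
  refine ⟨min a a', E, ?_, ?_⟩
  · intro d hd
    simp only [hE, Finset.mem_union, Finset.mem_filter] at hd
    rcases hd with (hd | hd) | hd
    exacts [hD d hd, hD' d hd, hd.2]
  · rintro τ (hτ | hτ)
    · have := AddSubmonoid.add_mem _ (key (a - min a a') (by simp))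
        (AddSubmonoid.closure_mono (t := (E : Set ℝ)) (by
          intro x hx
          simp only [hE, Finset.coe_union]
          exact Or.inl (Or.inl hx)) (H τ hτ))
      convert this using 1
      ring
    · have := AddSubmonoid.add_mem _ (key (a' - min a a') (by simp))
        (AddSubmonoid.closure_mono (t := (E : Set ℝ)) (by
          intro x hx
          simp only [hE, Finset.coe_union]
          exact Or.inl (Or.inr hx)) (H' τ hτ))
      convert this using 1
      ring

theorem inSum_add {S S' T : Set ℝ} (h : InSumOfProgressions S) (h' : InSumOfProgressions S')
    (hT : ∀ τ ∈ T, ∃ x ∈ S, ∃ y ∈ S', x + y = τ) : InSumOfProgressions T := by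
  classical
  rw [inSum_iff] at *
  obtain ⟨a, D, hD, H⟩ := h
  obtain ⟨a', D', hD', H'⟩ := h'
  refine ⟨a + a', D ∪ D', ?_, ?_⟩
  · intro d hd
    rcases Finset.mem_union.1 hd with hd | hd
    exacts [hD d hd, hD' d hd]
  · intro τ hτ
    obtain ⟨x, hx, y, hy, rfl⟩ := hT τ hτ
    have := AddSubmonoid.add_mem _
      (AddSubmonoid.closure_mono (t := ((D ∪ D' : Finset ℝ) : Set ℝ)) (by simp) (H x hx))
      (AddSubmonoid.closure_mono (t := ((D ∪ D' : Finset ℝ) : Set ℝ)) (by simp) (H' y hy))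
    convert this using 1
    ring

theorem closure_finite_below (D : Finset ℝ) (hD : ∀ d ∈ D, 0 < d) (X : ℝ) :
    {s ∈ AddSubmonoid.closure (D : Set ℝ) | s ≤ X}.Finite := by
  classical
  refine ((Set.finite_Iic (fun d : D => ⌈X / (d : ℝ)⌉₊)).image
    (fun f => ∑ d : D, f d • (d : ℝ))).subset ?_
  rintro s ⟨hs, hX⟩
  obtain ⟨f, -, rfl⟩ := AddSubmonoid.mem_closure_finset.1 hs
  refine ⟨fun d => f d, ?_, Finset.sum_coe_sort D (fun x => f x • x)⟩
  intro d
  have hd := hD d d.2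
  have h1 : f d • (d : ℝ) ≤ ∑ x ∈ D, f x • x :=
    Finset.single_le_sum (f := fun x => f x • x)
      (fun x hx => nsmul_nonneg (hD x hx).le _) d.2
  have h2 : (f d : ℝ) ≤ X / (d : ℝ) := by
    rw [le_div_iff₀ hd, ← nsmul_eq_mul]
    exact h1.trans hX
  exact_mod_cast h2.trans (Nat.le_ceil _)

theorem closure_nonneg {D : Finset ℝ} (hD : ∀ d ∈ D, 0 < d) {s : ℝ}
    (hs : s ∈ AddSubmonoid.closure (D : Set ℝ)) : 0 ≤ s := by
  induction hs using AddSubmonoid.closure_induction with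
  | mem x hx => exact (hD x hx).le
  | zero => exact le_rfl
  | add x y _ _ hx hy => exact add_nonneg hx hy

theorem inSum_pos {S : Set ℝ} (h : InSumOfProgressions S) (hS : ∀ τ ∈ S, 0 < τ) :
    ∃ D : Finset ℝ, (∀ d ∈ D, 0 < d) ∧ S ⊆ AddSubmonoid.closure (D : Set ℝ) := by
  classical
  obtain ⟨a, D, hD, H⟩ := (inSum_iff S).1 h
  set X : ℝ := |a| + ∑ d ∈ D, d with hX
  have hX0 : 0 ≤ X := add_nonneg (abs_nonneg _) (Finset.sum_nonneg fun d hd => (hD d hd).le)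
  set G : Finset ℝ := (closure_finite_below D hD X).toFinset with hG
  set E : Finset ℝ := D ∪ (G.image (a + ·)).filter (0 < ·) with hE
  refine ⟨E, ?_, ?_⟩
  · intro d hd
    rcases Finset.mem_union.1 hd with hd | hd
    exacts [hD d hd, (Finset.mem_filter.1 hd).2]
  have key : ∀ s ∈ AddSubmonoid.closure (D : Set ℝ), 0 < a + s →
      a + s ∈ AddSubmonoid.closure (E : Set ℝ) := by
    have small : ∀ s ∈ AddSubmonoid.closure (D : Set ℝ), s ≤ X → 0 < a + s →
        a + s ∈ AddSubmonoid.closure (E : Set ℝ) := by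
      intro s hs hsX h0
      refine AddSubmonoid.subset_closure ?_
      rw [Finset.mem_coe, hE, Finset.mem_union, Finset.mem_filter]
      refine Or.inr ⟨Finset.mem_image_of_mem _ ?_, h0⟩
      rw [hG, Set.Finite.mem_toFinset]
      exact ⟨hs, hsX⟩
    intro s hs
    induction hs using AddSubmonoid.closure_induction_left with
    | zero => exact small 0 (AddSubmonoid.zero_mem _) hX0
    | add_left d hd s hs ih =>
      intro h0
      by_cases hle : d + s ≤ X
      · exact small _ (AddSubmonoid.add_mem _ (AddSubmonoid.subset_closure hd) hs) hle h0
      · have hd1 : d ≤ ∑ d ∈ D, d :=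
          Finset.single_le_sum (f := fun x => x) (fun x hx => (hD x hx).le) hd
        have h1 : 0 < a + s := by
          have := neg_abs_le a
          push Not at hle
          linarith
        have := AddSubmonoid.add_mem _ (AddSubmonoid.subset_closure
          (show d ∈ (E : Set ℝ) by
            rw [Finset.mem_coe, hE, Finset.mem_union]
            exact Or.inl hd)) (ih h1)
        convert this using 1
        ring
  intro τ hτ
  have := key (τ - a) (H τ hτ) (by simpa using hS τ hτ)
  simpa using this

theorem mul_summable {x y : HahnSeries ℝ ℂ} {t : ℝ} (ht : 0 < t)
    (hx : Summable fun τ : ℝ => ‖x.coeff τ‖ * t ^ τ)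
    (hy : Summable fun τ : ℝ => ‖y.coeff τ‖ * t ^ τ) :
    Summable fun τ : ℝ => ‖(x * y).coeff τ‖ * t ^ τ := by
  have hp := hx.mul_of_nonneg hy (fun τ => by positivity) (fun τ => by positivity)
  let e : ℝ × ℝ ≃ ℝ × ℝ :=
    { toFun := fun p => (p.2, p.1 - p.2)
      invFun := fun p => (p.1 + p.2, p.1)
      left_inv := fun p => by ext <;> simp
      right_inv := fun p => by ext <;> simp }
  have hq := (e.summable_iff).2 hp
  refine Summable.of_nonneg_of_le (fun τ => by positivity) (fun τ => ?_) hq.prod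
  have hr : Summable fun σ : ℝ => ‖x.coeff σ‖ * t ^ σ * (‖y.coeff (τ - σ)‖ * t ^ (τ - σ)) :=
    hq.prod_factor τ
  rw [HahnSeries.coeff_mul]
  set A := Finset.antidiagonal x.isPWO_support y.isPWO_support τ with hA
  have hinj : Set.InjOn (Prod.fst : ℝ × ℝ → ℝ) (A : Set (ℝ × ℝ)) := by
    intro p hp q hq h
    have h1 := (Finset.mem_antidiagonal.1 hp).2.2
    have h2 := (Finset.mem_antidiagonal.1 hq).2.2
    ext
    · exact h
    · linarith
  calc ‖∑ ij ∈ A, x.coeff ij.1 * y.coeff ij.2‖ * t ^ τ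
      ≤ (∑ ij ∈ A, ‖x.coeff ij.1 * y.coeff ij.2‖) * t ^ τ := by
        gcongr
        exact norm_sum_le _ _
    _ = ∑ ij ∈ A, ‖x.coeff ij.1‖ * t ^ ij.1 * (‖y.coeff (τ - ij.1)‖ * t ^ (τ - ij.1)) := by
        rw [Finset.sum_mul]
        refine Finset.sum_congr rfl fun p hp => ?_
        have h1 := (Finset.mem_antidiagonal.1 hp).2.2
        have h2 : τ - p.1 = p.2 := by linarith
        rw [h2, norm_mul, ← h1, Real.rpow_add ht]
        ring
    _ = ∑ σ ∈ A.image Prod.fst, ‖x.coeff σ‖ * t ^ σ * (‖y.coeff (τ - σ)‖ * t ^ (τ - σ)) :=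
        (Finset.sum_image (f := fun σ : ℝ =>
          ‖x.coeff σ‖ * t ^ σ * (‖y.coeff (τ - σ)‖ * t ^ (τ - σ))) hinj).symm
    _ ≤ _ := hr.sum_le_tsum _ fun σ _ => by positivity

theorem isConvergent_single (a : ℝ) (c : ℂ) : IsConvergent (HahnSeries.single a c) := by
  refine ⟨inSum_mono HahnSeries.support_single_subset (inSum_singleton a), ?_⟩
  refine Eventually.of_forall fun t => ?_
  refine summable_of_ne_finset_zero (s := {a}) fun τ hτ => ?_
  rw [HahnSeries.coeff_single_of_ne (by simpa using hτ)]
  simp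

theorem IsConvergent.add {x y : HahnSeries ℝ ℂ} (hx : IsConvergent x) (hy : IsConvergent y) :
    IsConvergent (x + y) := by
  refine ⟨inSum_mono (HahnSeries.support_add_subset _ _) (inSum_union hx.1 hy.1), ?_⟩
  filter_upwards [hx.2, hy.2, self_mem_nhdsWithin] with t h1 h2 ht
  have ht : 0 < t := ht
  refine Summable.of_nonneg_of_le (fun τ => by positivity) (fun τ => ?_) (h1.add h2)
  rw [HahnSeries.coeff_add, ← add_mul]
  gcongr
  exact norm_add_le _ _

theorem IsConvergent.mul {x y : HahnSeries ℝ ℂ} (hx : IsConvergent x) (hy : IsConvergent y) :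
    IsConvergent (x * y) := by
  refine ⟨inSum_add hx.1 hy.1 fun τ hτ => ?_, ?_⟩
  · exact HahnSeries.support_mul_subset hτ
  · filter_upwards [hx.2, hy.2, self_mem_nhdsWithin] with t h1 h2 ht
    exact mul_summable ht h1 h2

theorem IsConvergent.neg {x : HahnSeries ℝ ℂ} (hx : IsConvergent x) : IsConvergent (-x) := by
  refine ⟨by simpa using hx.1, ?_⟩
  simpa using hx.2

theorem eventually_tsum_le_half {u : HahnSeries ℝ ℂ} (hu : IsConvergent u)
    (hpos : ∀ τ ∈ u.support, 0 < τ) :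
    ∀ᶠ t : ℝ in 𝓝[>] 0, ∑' τ : ℝ, ‖u.coeff τ‖ * t ^ τ ≤ 1 / 2 := by
  obtain ⟨T, hT, hT0⟩ := (hu.2.and self_mem_nhdsWithin).exists
  have hT0 : 0 < T := hT0
  have lim : Tendsto (fun t : ℝ => ∑' τ : ℝ, ‖u.coeff τ‖ * t ^ τ) (𝓝[>] 0)
      (𝓝 (∑' _ : ℝ, (0 : ℝ))) := by
    refine tendsto_tsum_of_dominated_convergence hT (fun τ => ?_) ?_
    · by_cases hτ : τ ∈ u.support
      · have h1 : Tendsto (fun t : ℝ => t ^ τ) (𝓝[>] 0) (𝓝 0) := by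
          have := (Real.continuousAt_rpow_const 0 τ (Or.inr (hpos τ hτ).le)).tendsto
          rw [Real.zero_rpow (hpos τ hτ).ne'] at this
          exact this.mono_left nhdsWithin_le_nhds
        simpa using h1.const_mul ‖u.coeff τ‖
      · have h0 : u.coeff τ = 0 := by simpa using hτ
        simp [h0]
    · filter_upwards [Ioo_mem_nhdsGT hT0] with t ht τ
      by_cases hτ : τ ∈ u.support
      · have h0 : 0 ≤ ‖u.coeff τ‖ * t ^ τ := mul_nonneg (norm_nonneg _) (Real.rpow_nonneg ht.1.le _)
        rw [Real.norm_of_nonneg h0]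
        exact mul_le_mul_of_nonneg_left
          (Real.rpow_le_rpow ht.1.le ht.2.le (hpos τ hτ).le) (norm_nonneg _)
      · have h0 : u.coeff τ = 0 := by simpa using hτ
        simp [h0]
  rw [tsum_zero] at lim
  exact lim.eventually_le_const (by norm_num)

theorem isConvergent_of_one_sub {u y : HahnSeries ℝ ℂ} (hu : IsConvergent u)
    (hpos : ∀ τ ∈ u.support, 0 < τ) (hy : y = 1 + u * y) : IsConvergent y := by
  classical
  obtain ⟨D, hD, hsub⟩ := inSum_pos hu.1 hpos
  have hsupp : ∀ τ ∈ y.support, τ ∈ AddSubmonoid.closure (D : Set ℝ) := by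
    intro τ hτ
    refine Set.WellFoundedOn.induction (r := (· < ·)) y.isPWO_support.isWF hτ ?_
    intro σ hσ ih
    by_cases h0 : σ = 0
    · rw [h0]
      exact AddSubmonoid.zero_mem _
    have h1 : (u * y).coeff σ ≠ 0 := by
      have h2 : y.coeff σ ≠ 0 := hσ
      rw [hy, HahnSeries.coeff_add, HahnSeries.coeff_one, if_neg h0, zero_add] at h2
      exact h2
    obtain ⟨a, ha, b, hb, rfl⟩ := HahnSeries.support_mul_subset (show σ ∈ (u * y).support from h1)
    exact AddSubmonoid.add_mem _ (hsub ha) (ih b hb (by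
      have := hpos a ha
      simpa using this))
  refine ⟨(inSum_iff _).2 ⟨0, D, hD, fun τ hτ => by simpa using hsupp τ hτ⟩, ?_⟩
  filter_upwards [hu.2, eventually_tsum_le_half hu hpos, self_mem_nhdsWithin] with t h1 h2 ht
  have ht : 0 < t := ht
  have bound : ∀ X : ℝ,
      ∑ τ ∈ (closure_finite_below D hD X).toFinset, ‖y.coeff τ‖ * t ^ τ ≤ 2 := by
    intro X
    set F := (closure_finite_below D hD X).toFinset with hF
    have memF : ∀ s, s ∈ F ↔ s ∈ AddSubmonoid.closure (D : Set ℝ) ∧ s ≤ X := fun s => by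
      rw [hF, Set.Finite.mem_toFinset]
      rfl
    have s1 : ∑ τ ∈ F, ‖(1 : HahnSeries ℝ ℂ).coeff τ‖ * t ^ τ ≤ 1 := by
      have : ∀ τ ∈ F, ‖(1 : HahnSeries ℝ ℂ).coeff τ‖ * t ^ τ = if τ = 0 then 1 else 0 := by
        intro τ _
        rw [HahnSeries.coeff_one]
        split_ifs with h
        · simp [h]
        · simp
      rw [Finset.sum_congr rfl this, Finset.sum_ite_eq']
      split_ifs <;> norm_num
    have s2 : ∑ τ ∈ F, ‖(u * y).coeff τ‖ * t ^ τ ≤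
        (∑ τ ∈ F, ‖u.coeff τ‖ * t ^ τ) * ∑ τ ∈ F, ‖y.coeff τ‖ * t ^ τ := by
      rw [Finset.sum_mul_sum, ← Finset.sum_product']
      refine le_trans (Finset.sum_le_sum fun τ hτ => ?_)
        (Finset.sum_fiberwise_le_sum_of_sum_fiber_nonneg (t := F)
          (g := fun p : ℝ × ℝ => p.1 + p.2) fun τ _ =>
            Finset.sum_nonneg fun p _ => by positivity)
      rw [HahnSeries.coeff_mul]
      calc ‖∑ ij ∈ Finset.antidiagonal u.isPWO_support y.isPWO_support τ,
              u.coeff ij.1 * y.coeff ij.2‖ * t ^ τ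
          ≤ (∑ ij ∈ Finset.antidiagonal u.isPWO_support y.isPWO_support τ,
              ‖u.coeff ij.1 * y.coeff ij.2‖) * t ^ τ := by
            gcongr
            exact norm_sum_le _ _
        _ = ∑ p ∈ Finset.antidiagonal u.isPWO_support y.isPWO_support τ,
              ‖u.coeff p.1‖ * t ^ p.1 * (‖y.coeff p.2‖ * t ^ p.2) := by
            rw [Finset.sum_mul]
            refine Finset.sum_congr rfl fun p hp => ?_
            have h1 := (Finset.mem_antidiagonal.1 hp).2.2
            rw [norm_mul, ← h1, Real.rpow_add ht]
            ring
        _ ≤ _ := by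
            refine Finset.sum_le_sum_of_subset_of_nonneg (fun p hp => ?_)
              fun p _ _ => by positivity
            obtain ⟨ha, hb, hab⟩ := Finset.mem_antidiagonal.1 hp
            have hX := ((memF τ).1 hτ).2
            have ha' := hsub ha
            have hb' := hsupp _ hb
            have ha0 := closure_nonneg hD ha'
            have hb0 := closure_nonneg hD hb'
            rw [Finset.mem_filter, Finset.mem_product, memF, memF]
            exact ⟨⟨⟨ha', by linarith⟩, ⟨hb', by linarith⟩⟩, hab⟩
    have s3 : ∑ τ ∈ F, ‖u.coeff τ‖ * t ^ τ ≤ 1 / 2 :=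
      (h1.sum_le_tsum F fun τ _ => by positivity).trans h2
    have s4 : ∑ τ ∈ F, ‖y.coeff τ‖ * t ^ τ ≤
        ∑ τ ∈ F, ‖(1 : HahnSeries ℝ ℂ).coeff τ‖ * t ^ τ +
          ∑ τ ∈ F, ‖(u * y).coeff τ‖ * t ^ τ := by
      rw [← Finset.sum_add_distrib]
      refine Finset.sum_le_sum fun τ _ => ?_
      rw [← add_mul]
      have : y.coeff τ = (1 : HahnSeries ℝ ℂ).coeff τ + (u * y).coeff τ := by
        rw [← HahnSeries.coeff_add, ← hy]
      rw [this]
      gcongr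
      exact norm_add_le _ _
    have s5 : 0 ≤ ∑ τ ∈ F, ‖y.coeff τ‖ * t ^ τ := Finset.sum_nonneg fun τ _ => by positivity
    nlinarith [mul_le_mul_of_nonneg_right s3 s5]
  refine summable_of_sum_le (c := 2) (fun τ => by positivity) fun U => ?_
  refine le_trans ?_ (bound (∑ τ ∈ U, |τ|))
  rw [← Finset.sum_filter_of_ne (s := U) (p := fun τ => τ ∈ y.support) (fun τ _ h => by
    intro h0
    simp [h0] at h)]
  refine Finset.sum_le_sum_of_subset_of_nonneg (fun τ hτ => ?_) fun τ _ _ => by positivity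
  obtain ⟨hU, hs⟩ := Finset.mem_filter.1 hτ
  rw [Set.Finite.mem_toFinset]
  exact ⟨hsupp τ hs, (le_abs_self τ).trans
    (Finset.single_le_sum (f := fun τ : ℝ => |τ|) (fun _ _ => abs_nonneg _) hU)⟩

theorem IsConvergent.inv {b : HahnSeries ℝ ℂ} (hb : IsConvergent b) : IsConvergent b⁻¹ := by
  by_cases h0 : b = 0
  · simpa [h0] using hb
  set c := b.coeff b.order with hc
  have hc0 : c ≠ 0 := HahnSeries.coeff_order_eq_zero.not.2 h0
  set x : HahnSeries ℝ ℂ := HahnSeries.single (-b.order) c⁻¹ with hx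
  have hx0 : x ≠ 0 := HahnSeries.single_ne_zero (inv_ne_zero hc0)
  have hxc : IsConvergent x := isConvergent_single _ _
  set u : HahnSeries ℝ ℂ := 1 + -(x * b) with hu
  have huc : IsConvergent u := (isConvergent_single 0 1).add (hxc.mul hb).neg
  have hpos : ∀ τ ∈ u.support, 0 < τ := by
    intro τ hτ
    by_contra hle
    push Not at hle
    refine hτ ?_
    rw [hu, HahnSeries.coeff_add, HahnSeries.coeff_neg, hx, HahnSeries.coeff_single_mul,
      HahnSeries.coeff_one]
    rcases hle.eq_or_lt with h | h
    · simp [h, ← hc, hc0]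
    · rw [if_neg h.ne, HahnSeries.coeff_eq_zero_of_lt_order (by linarith)]
      simp
  have hxb : x * b ≠ 0 := mul_ne_zero hx0 h0
  have hy : (x * b)⁻¹ = 1 + u * (x * b)⁻¹ := by
    rw [hu]
    field_simp
    ring
  have := hxc.mul (isConvergent_of_one_sub huc hpos hy)
  convert this using 1
  field_simp

/-- The field of convergent Puiseux series over `ℂ`, inside the field of Hahn series. -/
def field : Subfield (HahnSeries ℝ ℂ) where
  carrier := {b | IsConvergent b}
  mul_mem' := IsConvergent.mul
  one_mem' := isConvergent_single 0 1
  add_mem' := IsConvergent.add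
  zero_mem' := by simpa using isConvergent_single 0 0
  neg_mem' := IsConvergent.neg
  inv_mem' := fun _ => IsConvergent.inv

/-- `Val (∑ c_τ t ^ τ) = - min {τ | c_τ ≠ 0}` (only used for nonzero series). -/
def val (b : field) : ℝ := -(b : HahnSeries ℝ ℂ).order

end ConvPuiseux

/-! ### Non-Archimedean amoebas -/

namespace NonArchAmoeba

open scoped AddMonoidAlgebra

variable {K : Type*} [Field K] {k : ℕ}

/-- The value of the Laurent polynomial `f = ∑ c_ω z ^ ω` at a point `z` of the torus `(Kˣ)^k`. -/
def eval (f : K[Fin k → ℤ]) (z : Fin k → Kˣ) : K :=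
  f.coeff.sum fun ω c => c * ∏ j, (z j : K) ^ ω j

/-- The amoeba `Val {z ∈ (Kˣ)^k | f z = 0} ⊆ ℝ^k` of a Laurent polynomial `f`, where
`Val : K → ℝ` (only used on `Kˣ`) is applied coordinatewise. -/
def amoeba (Val : K → ℝ) (f : K[Fin k → ℤ]) : Set (Fin k → ℝ) :=
  (fun z j => Val (z j)) '' {z : Fin k → Kˣ | eval f z = 0}

/-- The set of amoebas of the Laurent polynomials `∑_{ω ∈ I} c_ω z ^ ω` with all `c_ω ≠ 0`. -/
def amoebas (Val : K → ℝ) (I : Finset (Fin k → ℤ)) : Set (Set (Fin k → ℝ)) :=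
  {A | ∃ f : K[Fin k → ℤ], f.coeff.support = I ∧ A = amoeba Val f}

end NonArchAmoeba

end

/-! By Kapranov's theorem an amoeba is a tropical hypersurface: `x` lies in the amoeba of `f = ∑ c_ω
z ^ ω` exactly when the maximum over `ω ∈ I` of `Val c_ω + ω · x` is attained at least twice
(`twiceMax_of_mem_amoeba`, `mem_amoeba_of_twiceMax`). With `a ω = Val c_ω`, passing through `x_1, …,
x_n` becomes a tropical linear system of `n` equations in `n + 1` unknowns. Adding a constant to `a`
does not change the hypersurface, so it suffices that the system has a solution and that the
solution is unique up to a constant.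

A solution exists for every tuple, by a tropical Cramer rule: `a ω` is the tropical minor of the
matrix `(ω · x_i)` with column `ω` removed (`exists_forall_twiceMax`).

For uniqueness, choose for each `i` two exponents at which the `i`-th maximum is attained and join
them by an edge. A linear dependence among the edges would eliminate `a` from the `n` equalities and
leave a nontrivial linear equation for the `x_i`. There are finitely many possible edge systems, and
one such equation for each dependent one gives the excluded hyperplanes (`exists_generic`). Away
from them the `n` edges form a spanning tree on `n + 1` vertices, and its orientation away from a
vertex `ω` matches the edges with the other vertices. Comparing two solutions along these matchings
bounds their difference from both sides by the same constant (`sub_const`).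

The field enters only through algebraic closedness and surjectivity of the valuation. For convergent
Puiseux series, closedness is proved by the Newton–Puiseux method over the valuation ring
(`exists_root_of_multiplicity`). Its Hensel step is a fixed point iteration that contracts for the
order of vanishing and stays bounded in a weighted norm, which gives convergence
(`exists_fixed_point`). -/

/-! ### Tropical hyperplanes through points in general position -/

namespace Tropical

/-- The maximum of `f` is attained at least twice. -/
def TwiceMax {ι : Type*} (f : ι → ℝ) : Prop :=
  ∃ α β, α ≠ β ∧ f α = f β ∧ ∀ γ, f γ ≤ f α

/-- A tropical linear system of `n` equations in `n + 1` unknowns has a finite solution. -/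
theorem exists_forall_twiceMax {ι : Type*} [Fintype ι] {n : ℕ} (hc : Fintype.card ι = n + 1)
    (M : Fin n → ι → ℝ) : ∃ a : ι → ℝ, ∀ i, TwiceMax fun w => a w + M i w := by
  classical
  have e0 : Option (Fin n) ≃ ι := Fintype.equivOfCardEq (by simp [hc])
  let W : (Option (Fin n) ≃ ι) → ℝ := fun σ => ∑ j, M j (σ (some j))
  have hex : ∀ w : ι, ∃ σ : Option (Fin n) ≃ ι, σ none = w ∧
      ∀ τ : Option (Fin n) ≃ ι, τ none = w → W τ ≤ W σ := fun w => by
    obtain ⟨σ, h1, h2⟩ := Set.exists_max_image {σ : Option (Fin n) ≃ ι | σ none = w} W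
      (Set.toFinite _) ⟨(Equiv.swap none (e0.symm w)).trans e0, by simp⟩
    exact ⟨σ, h1, h2⟩
  choose s hs hmax using hex
  -- Tropical Cramer rule: the unknown at `w` is the tropical minor without column `w`.
  refine ⟨fun w => W (s w), fun i => ?_⟩
  -- Row `i` is repeated as the row `none`. Expanding the tropical determinant of this square matrix
  -- along `none` gives the maximum of `a w + M i w`.
  let M' : Option (Fin n) → ι → ℝ := fun o => o.elim (M i) M
  have total : ∀ σ : Option (Fin n) ≃ ι, ∑ o, M' o (σ o) = W σ + M i (σ none) := fun σ => by
    rw [Fintype.sum_option, add_comm]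
    rfl
  have : Nonempty (Option (Fin n) ≃ ι) := ⟨e0⟩
  obtain ⟨σ, hσ⟩ := Finite.exists_max fun σ : Option (Fin n) ≃ ι => ∑ o, M' o (σ o)
  have le : ∀ γ, W (s γ) + M i γ ≤ ∑ o, M' o (σ o) := fun γ => by
    have := hσ (s γ)
    rwa [total (s γ), hs] at this
  have ge : ∀ τ : Option (Fin n) ≃ ι, ∑ o, M' o (τ o) ≤ W (s (τ none)) + M i (τ none) := fun τ => by
    rw [total]
    gcongr
    exact hmax _ _ rfl
  -- Exchanging the two equal rows in an optimal bijection keeps its weight but changes the column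
  -- of `none`; this is the second place where the maximum is attained.
  let τ := (Equiv.swap none (some i)).trans σ
  have hτ : ∑ o, M' o (τ o) = ∑ o, M' o (σ o) := by
    rw [← Equiv.sum_comp (Equiv.swap none (some i)) fun o => M' o (σ o)]
    refine Finset.sum_congr rfl fun o _ => ?_
    have : M' (Equiv.swap none (some i) o) = M' o := by
      rcases o with _ | j
      · simp [M']
      · by_cases h : j = i
        · simp [M', h]
        · rw [Equiv.swap_apply_of_ne_of_ne (by simp) (by simpa using h)]
    rw [this]
    rfl
  have e1 := le_antisymm (le (σ none)) (ge σ)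
  have e2 := le_antisymm (le (τ none)) (hτ ▸ ge τ)
  refine ⟨σ none, τ none, ?_, e1.trans e2.symm, fun γ => (le γ).trans e1.ge⟩
  simp [τ]

/-! ### Uniqueness of the tropical solution by spanning trees -/

/-- The edges `{α i, β i}` form a forest. -/
def Indep {ι : Type*} [DecidableEq ι] {n : ℕ} (α β : Fin n → ι) : Prop :=
  ∀ c : Fin n → ℝ, ∑ i, c i • (Pi.single (α i) 1 - Pi.single (β i) 1 : ι → ℝ) = 0 → c = 0

/-- Orient the spanning tree away from `w` and send each edge to its head. Algebraically: the
incidence matrix without column `w` is invertible, because each of its full rows sums to zero and so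
a relation that holds off `w` also holds at `w`. Hence some term of the Leibniz expansion of the
determinant is nonzero, and that term is the matching. -/
theorem Indep.exists_matching {ι : Type*} [Fintype ι] [DecidableEq ι] {n : ℕ}
    (hc : Fintype.card ι = n + 1) {α β : Fin n → ι} (h : Indep α β) (w : ι) :
    ∃ σ : Fin n ≃ {w' // w' ≠ w}, ∀ i, (σ i : ι) = α i ∨ (σ i : ι) = β i := by
  have e : Fin n ≃ {w' // w' ≠ w} := Fintype.equivOfCardEq (by
    rw [Fintype.card_fin, Fintype.card_subtype_compl, hc, Fintype.card_subtype_eq]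
    simp)
  let r : Fin n → ι → ℝ := fun i => Pi.single (α i) 1 - Pi.single (β i) 1
  let N : Matrix (Fin n) (Fin n) ℝ := Matrix.of fun i j => r i (e j)
  have hdet : N.det ≠ 0 := by
    rw [Ne, ← Matrix.exists_vecMul_eq_zero_iff]
    rintro ⟨c, hc0, hcN⟩
    refine hc0 (h c ?_)
    have off : ∀ w', w' ≠ w → (∑ i, c i • r i) w' = 0 := fun w' hw' => by
      have := congrFun hcN (e.symm ⟨w', hw'⟩)
      simpa [Matrix.vecMul, dotProduct, N] using this
    have tot : ∑ w', (∑ i, c i • r i) w' = 0 := by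
      simp only [Finset.sum_apply, Pi.smul_apply, smul_eq_mul]
      rw [Finset.sum_comm]
      refine Finset.sum_eq_zero fun i _ => ?_
      rw [← Finset.mul_sum]
      simp [r]
    funext w'
    by_cases hw : w' = w
    · rw [Finset.sum_eq_single w (fun b _ hb => off b hb) (by simp)] at tot
      rw [hw]
      exact tot
    · exact off w' hw
  rw [Matrix.det_apply] at hdet
  obtain ⟨p, -, hp⟩ := Finset.exists_ne_zero_of_sum_ne_zero hdet
  have hprod : ∏ i, N (p i) i ≠ 0 := fun h0 => hp (by rw [h0, smul_zero])
  refine ⟨p.symm.trans e, fun i => ?_⟩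
  have hi := Finset.prod_ne_zero_iff.1 hprod (p.symm i) (Finset.mem_univ _)
  by_contra! hne
  refine hi ?_
  simp only [Equiv.trans_apply] at hne
  simp [N, r, Pi.single_apply, hne.1, hne.2]

/-- Sum the equalities for `a` and the inequalities for `b` along a matching that avoids `w`: the
entries of `M` cancel. The resulting bound does not depend on `w`, and it changes sign when `(a, m)`
and `(b, m')` are exchanged. -/
theorem Indep.sub_le {ι : Type*} [Fintype ι] [DecidableEq ι] {n : ℕ}
    (hc : Fintype.card ι = n + 1) {α β : Fin n → ι} (h : Indep α β) {M : Fin n → ι → ℝ}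
    {a b : ι → ℝ} {m m' : Fin n → ℝ} (hα : ∀ i, a (α i) + M i (α i) = m i)
    (hβ : ∀ i, a (β i) + M i (β i) = m i) (hb : ∀ i w, b w + M i w ≤ m' i) (w : ι) :
    a w - b w ≤ (∑ i, m' i - ∑ w, b w) - (∑ i, m i - ∑ w, a w) := by
  obtain ⟨σ, hσ⟩ := h.exists_matching hc w
  have h1 : ∑ i, (a (σ i) + M i (σ i)) = ∑ i, m i := Finset.sum_congr rfl fun i _ => by
    rcases hσ i with h | h <;> rw [h]
    exacts [hα i, hβ i]
  have h2 : ∑ i, (b (σ i) + M i (σ i)) ≤ ∑ i, m' i := Finset.sum_le_sum fun i _ => hb i _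
  have h3 : ∀ f : ι → ℝ, ∑ i, f (σ i) = ∑ w, f w - f w := fun f => by
    rw [Equiv.sum_comp σ fun w' => f w', Fintype.sum_eq_add_sum_subtype_ne f w]
    ring
  rw [Finset.sum_add_distrib, h3] at h1 h2
  linarith

/-- `Indep.sub_le` for the tree of `a` and for the tree of `b` gives opposite bounds with the same
constant, so both are equalities. -/
theorem sub_const {ι : Type*} [Fintype ι] [DecidableEq ι] {n : ℕ}
    (hc : Fintype.card ι = n + 1) {M : Fin n → ι → ℝ}
    (hM : ∀ (a : ι → ℝ) (α β : Fin n → ι), (∀ i, α i ≠ β i) →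
      (∀ i, a (α i) + M i (α i) = a (β i) + M i (β i)) → Indep α β)
    {a b : ι → ℝ} (ha : ∀ i, TwiceMax fun w => a w + M i w)
    (hb : ∀ i, TwiceMax fun w => b w + M i w) : ∃ C, ∀ w, a w = b w + C := by
  choose α β hne he hmax using ha
  choose α' β' hne' he' hmax' using hb
  have h1 := (hM a α β hne he).sub_le hc (fun _ => rfl) (fun i => (he i).symm) hmax'
  have h2 := (hM b α' β' hne' he').sub_le hc (fun _ => rfl) (fun i => (he' i).symm) hmax
  refine ⟨(∑ i, (b (α' i) + M i (α' i)) - ∑ w, b w) -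
    (∑ i, (a (α i) + M i (α i)) - ∑ w, a w), fun w => ?_⟩
  have := h1 w
  have := h2 w
  linarith

/-! ### The excluded hyperplanes -/

/-- The value of the linear form `w` at the point `x`. -/
def dot {k : ℕ} (w : Fin k → ℤ) (x : Fin k → ℝ) : ℝ := ∑ j, (w j : ℝ) * x j

/-- The linear form `x ↦ ∑ i, c i * (α i - β i) · x i`. -/
def edgeForm {k n : ℕ} (c : Fin n → ℝ) (α β : Fin n → Fin k → ℤ) :
    Module.Dual ℝ (Fin n → Fin k → ℝ) :=
  ∑ i, ∑ j, (c i * ((α i j : ℝ) - β i j)) •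
    ((LinearMap.proj j : (Fin k → ℝ) →ₗ[ℝ] ℝ) ∘ₗ
      (LinearMap.proj i : (Fin n → Fin k → ℝ) →ₗ[ℝ] Fin k → ℝ))

theorem edgeForm_apply {k n : ℕ} (c : Fin n → ℝ) (α β : Fin n → Fin k → ℤ)
    (x : Fin n → Fin k → ℝ) :
    edgeForm c α β x = ∑ i, c i * (dot (α i) (x i) - dot (β i) (x i)) := by
  simp only [edgeForm, dot, LinearMap.sum_apply, LinearMap.smul_apply, LinearMap.comp_apply,
    LinearMap.proj_apply, smul_eq_mul]
  refine Finset.sum_congr rfl fun i _ => ?_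
  rw [← Finset.sum_sub_distrib, Finset.mul_sum]
  exact Finset.sum_congr rfl fun j _ => by ring

theorem edgeForm_ne_zero {k n : ℕ} {c : Fin n → ℝ} (hc : c ≠ 0) {α β : Fin n → Fin k → ℤ}
    (h : ∀ i, α i ≠ β i) : edgeForm c α β ≠ 0 := by
  classical
  obtain ⟨i, hi⟩ := Function.ne_iff.1 hc
  obtain ⟨j, hj⟩ := Function.ne_iff.1 (h i)
  intro h0
  have h1 := LinearMap.congr_fun h0 (Pi.single i (Pi.single j 1))
  rw [edgeForm_apply, Finset.sum_eq_single i (fun b _ hb => by simp [dot, hb]) (by simp)] at h1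
  simp only [dot, Pi.single_eq_same, Pi.single_apply, mul_ite, mul_one, mul_zero,
    Finset.sum_ite_eq', Finset.mem_univ, if_true, LinearMap.zero_apply, mul_eq_zero] at h1
  rcases h1 with h1 | h1
  · exact hi h1
  · exact hj (by exact_mod_cast sub_eq_zero.1 h1)

/-- For each dependent system of edges a nonzero relation `c` is fixed. If the ties hold for some
`a`, summing them with weights `c` cancels `a`, and `edgeForm c α β` vanishes at `x`. This form does
not involve `a`, so finitely many forms suffice. -/
theorem exists_generic {k n : ℕ} (I : Finset (Fin k → ℤ)) :
    ∃ H : Finset (Module.Dual ℝ (Fin n → Fin k → ℝ)), (∀ l ∈ H, l ≠ 0) ∧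
      ∀ x : Fin n → Fin k → ℝ, (∀ l ∈ H, l x ≠ 0) →
        ∀ (a : I → ℝ) (α β : Fin n → I), (∀ i, α i ≠ β i) →
          (∀ i, a (α i) + dot (α i) (x i) = a (β i) + dot (β i) (x i)) → Indep α β := by
  classical
  have hex : ∀ p : (Fin n → I) × (Fin n → I), ∃ c : Fin n → ℝ, ¬ Indep p.1 p.2 → c ≠ 0 ∧
      ∑ i, c i • (Pi.single (p.1 i) 1 - Pi.single (p.2 i) 1 : I → ℝ) = 0 := fun p => by
    by_cases h : Indep p.1 p.2
    · exact ⟨0, fun h' => absurd h h'⟩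
    · unfold Indep at h
      push Not at h
      obtain ⟨c, h1, h2⟩ := h
      exact ⟨c, fun _ => ⟨h2, h1⟩⟩
  choose c hc using hex
  refine ⟨(Finset.univ.filter fun p : (Fin n → I) × (Fin n → I) =>
    (∀ i, p.1 i ≠ p.2 i) ∧ ¬ Indep p.1 p.2).image
      fun p => edgeForm (c p) (fun i => (p.1 i : Fin k → ℤ)) (fun i => (p.2 i : Fin k → ℤ)), ?_, ?_⟩
  · intro l hl
    obtain ⟨p, hp, rfl⟩ := Finset.mem_image.1 hl
    obtain ⟨-, h1, h2⟩ := Finset.mem_filter.1 hp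
    exact edgeForm_ne_zero (hc p h2).1 fun i h => h1 i (Subtype.ext h)
  · intro x hx a α β hne he
    by_contra hI
    refine hx _ (Finset.mem_image_of_mem _ (Finset.mem_filter.2
      ⟨Finset.mem_univ (α, β), hne, hI⟩)) ?_
    have h0 := (hc (α, β) hI).2
    have h1 : ∑ w, (∑ i, c (α, β) i • (Pi.single (α i) 1 - Pi.single (β i) 1 : I → ℝ)) w * a w
        = 0 := by rw [h0]; simp
    simp only [Finset.sum_apply, Finset.sum_mul] at h1
    rw [Finset.sum_comm] at h1
    rw [edgeForm_apply, ← neg_eq_zero, ← Finset.sum_neg_distrib, ← h1]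
    refine Finset.sum_congr rfl fun i _ => ?_
    have h2 : ∑ w, (c (α, β) i • (Pi.single (α i) 1 - Pi.single (β i) 1 : I → ℝ)) w * a w
        = c (α, β) i * (a (α i) - a (β i)) := by
      simp [Pi.single_apply, sub_mul, mul_sub]
    rw [h2]
    have := he i
    linear_combination (-c (α, β) i) * this

end Tropical

/-! ### Amoebas of hypersurfaces over algebraically closed fields -/

namespace NonArchAmoeba

open Polynomial Tropical

variable {K : Type*} [Field K] (v : Valuation K ℝᵐ⁰) {k : ℕ}

/-! ### Univariate polynomials and roots of valuation one -/

/-- The polynomial `p` has a unique coefficient of maximal valuation. -/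
def HasDominant (p : K[X]) : Prop :=
  ∃ m, p.coeff m ≠ 0 ∧ ∀ j, j ≠ m → v (p.coeff j) < v (p.coeff m)

variable {v}

/-- In the product the dominant coefficient moves to index `m + 1` if `v r < 1`, where the factor
`X` prevails, and stays at `m` if `v r > 1`, where the constant `r` prevails. -/
theorem HasDominant.mul_X_sub_C {p : K[X]} (h : HasDominant v p) {r : K} (hr : v r ≠ 1) :
    HasDominant v (p * (X - C r)) := by
  obtain ⟨m, hm, hlt⟩ := h
  have hle : ∀ j, v (p.coeff j) ≤ v (p.coeff m) := fun j => by
    by_cases h : j = m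
    · rw [h]
    · exact (hlt j h).le
  have hpos : 0 < v (p.coeff m) := zero_lt_iff.2 ((Valuation.ne_zero_iff v).2 hm)
  have h0 : (p * (X - C r)).coeff 0 = -(p.coeff 0 * r) := by simp [mul_coeff_zero]
  rcases lt_or_gt_of_ne hr with hr | hr
  · have hsmall : ∀ j, v (p.coeff j * r) < v (p.coeff m) := fun j => by
      rw [map_mul]
      calc v (p.coeff j) * v r ≤ v (p.coeff m) * v r := by gcongr; exact hle j
        _ < v (p.coeff m) * 1 := by gcongr
        _ = _ := mul_one _
    have hv : v ((p * (X - C r)).coeff (m + 1)) = v (p.coeff m) := by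
      rw [coeff_mul_X_sub_C]
      exact v.map_sub_eq_of_lt_left (hsmall _)
    refine ⟨m + 1, (Valuation.ne_zero_iff v).1 (hv ▸ hpos.ne'), fun j hj => ?_⟩
    rw [hv]
    rcases j with _ | j
    · rw [h0, v.map_neg]
      exact hsmall 0
    · rw [coeff_mul_X_sub_C]
      exact (v.map_sub _ _).trans_lt (max_lt (hlt j (by simpa using hj)) (hsmall _))
  · have hbig : v (p.coeff m) < v (p.coeff m * r) := by
      rw [map_mul]
      calc v (p.coeff m) = v (p.coeff m) * 1 := (mul_one _).symm
        _ < _ := by gcongr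
    have hv : v ((p * (X - C r)).coeff m) = v (p.coeff m * r) := by
      rcases m with _ | m
      · rw [h0, v.map_neg]
      · rw [coeff_mul_X_sub_C]
        exact v.map_sub_eq_of_lt_right ((hle m).trans_lt hbig)
    refine ⟨m, (Valuation.ne_zero_iff v).1 (hv ▸ (hpos.trans hbig).ne'), fun j hj => ?_⟩
    have hj' : v (p.coeff j * r) < v (p.coeff m * r) := by
      rw [map_mul, map_mul]
      have : 0 < v r := zero_lt_one.trans hr
      gcongr
      exact hlt j hj
    rw [hv]
    rcases j with _ | j
    · rw [h0, v.map_neg]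
      exact hj'
    · rw [coeff_mul_X_sub_C]
      exact (v.map_sub _ _).trans_lt (max_lt ((hle j).trans_lt hbig) hj')

theorem hasDominant_of_roots [IsAlgClosed K] {p : K[X]} (hp : p ≠ 0)
    (h : ∀ r ∈ p.roots, v r ≠ 1) : HasDominant v p := by
  have key : ∀ s : Multiset K, (∀ r ∈ s, v r ≠ 1) →
      HasDominant v (C p.leadingCoeff * (s.map fun r => X - C r).prod) := fun s => by
    induction s using Multiset.induction_on with
    | empty =>
      intro _
      refine ⟨0, by simpa using hp, fun j hj => ?_⟩
      have : 0 < v p.leadingCoeff := zero_lt_iff.2 ((Valuation.ne_zero_iff v).2 (by simpa using hp))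
      simpa [coeff_C, hj] using this
    | cons r s ih =>
      intro hs
      rw [Multiset.map_cons, Multiset.prod_cons, mul_left_comm, mul_comm]
      exact (ih fun r' hr' => hs r' (Multiset.mem_cons_of_mem hr')).mul_X_sub_C
        (hs r (Multiset.mem_cons_self _ _))
  rw [(IsAlgClosed.splits p).eq_prod_roots]
  exact key _ h

/-- Otherwise all roots have valuation different from `1`; multiplying up the linear factors,
starting from a constant, keeps a single dominant coefficient. -/
theorem exists_root_of_two_max [IsAlgClosed K] {p : K[X]} {i j : ℕ} (hij : i ≠ j)
    (hi : p.coeff i ≠ 0) (he : v (p.coeff i) = v (p.coeff j))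
    (hmax : ∀ l, v (p.coeff l) ≤ v (p.coeff i)) : ∃ r, v r = 1 ∧ p.eval r = 0 := by
  have hp : p ≠ 0 := fun h => hi (by simp [h])
  by_contra! hne
  obtain ⟨m, -, hm⟩ := hasDominant_of_roots (v := v) hp fun r hr h1 =>
    hne r h1 ((mem_roots hp).1 hr)
  by_cases h : i = m
  · subst h
    exact (hm j hij.symm).ne he.symm
  · exact absurd (hm i h) (hmax m).not_gt

/-! ### Kapranov's theorem for hypersurfaces -/

/-- Take `u = (1, N, N ^ 2, …)`. Two points of `I` have the same product with `u` only if `N` is a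
root of the polynomial whose coefficients are the entries of their difference; an integer `N` avoids
these finitely many polynomials. -/
theorem exists_injOn_dot (I : Finset (Fin k → ℤ)) :
    ∃ u : Fin k → ℤ, Set.InjOn (fun w : Fin k → ℤ => ∑ j, w j * u j) I := by
  classical
  let q : (Fin k → ℤ) → ℤ[X] := fun w => ∑ j : Fin k, monomial (j : ℕ) (w j)
  have hq : ∀ w, w ≠ 0 → q w ≠ 0 := fun w hw h0 => by
    obtain ⟨j, hj⟩ := Function.ne_iff.1 hw
    apply hj
    have := congrArg (fun r => coeff r (j : ℕ)) h0
    simpa [q, finsetSum_coeff, coeff_monomial, Fin.val_inj] using this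
  let Q : ℤ[X] := ∏ p ∈ (I ×ˢ I).filter fun p => p.1 ≠ p.2, q (p.1 - p.2)
  have hQ : Q ≠ 0 := Finset.prod_ne_zero_iff.2 fun p hp =>
    hq _ (sub_ne_zero.2 (Finset.mem_filter.1 hp).2)
  obtain ⟨N, hN⟩ : ∃ N, Q.eval N ≠ 0 := by
    by_contra! h
    exact hQ (Polynomial.funext fun r => by simpa using h r)
  refine ⟨fun j => N ^ (j : ℕ), fun w hw w' hw' h => ?_⟩
  by_contra hne
  rw [eval_prod] at hN
  refine Finset.prod_ne_zero_iff.1 hN (w, w') (Finset.mem_filter.2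
    ⟨Finset.mem_product.2 ⟨hw, hw'⟩, hne⟩) ?_
  simpa [q, eval_finsetSum, sub_mul, sub_eq_zero] using h

theorem val_term {c : K} (hc : c ≠ 0) {z : Fin k → Kˣ} {x : Fin k → ℝ}
    (hz : ∀ j, WithZero.log (v (z j)) = x j) (w : Fin k → ℤ) :
    v (c * ∏ j, (z j : K) ^ w j) = WithZero.exp (WithZero.log (v c) + dot w x) := by
  have hprod : ∀ s : Finset (Fin k), v (∏ j ∈ s, (z j : K) ^ w j) =
      WithZero.exp (∑ j ∈ s, (w j : ℝ) * x j) := fun s => by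
    classical
    induction s using Finset.induction_on with
    | empty => simp
    | insert a s ha ih =>
      rw [Finset.prod_insert ha, Finset.sum_insert ha, map_mul, ih, map_zpow₀, ← hz,
        WithZero.exp_add, ← zsmul_eq_mul, WithZero.exp_zsmul,
        WithZero.exp_log ((Valuation.ne_zero_iff v).2 (z a).ne_zero)]
  rw [map_mul, hprod, WithZero.exp_add, WithZero.exp_log ((Valuation.ne_zero_iff v).2 hc), dot]

open scoped AddMonoidAlgebra

theorem eval_eq_sum {I : Finset (Fin k → ℤ)} {f : K[Fin k → ℤ]} (hf : f.coeff.support = I)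
    (z : Fin k → Kˣ) : eval f z = ∑ w : I, f.coeff w * ∏ j, (z j : K) ^ (w : Fin k → ℤ) j := by
  rw [eval, Finsupp.sum, hf, ← Finset.sum_coe_sort]

/-- If a single term had maximal valuation, the whole sum would have that valuation and could not
vanish. -/
theorem twiceMax_of_mem_amoeba {I : Finset (Fin k → ℤ)} (hI : I.Nonempty) {f : K[Fin k → ℤ]}
    (hf : f.coeff.support = I) {x : Fin k → ℝ} (hx : x ∈ amoeba (fun a => WithZero.log (v a)) f) :
    TwiceMax fun w : I => WithZero.log (v (f.coeff w)) + dot w x := by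
  classical
  obtain ⟨z, hz, rfl⟩ := hx
  have hc : ∀ w : I, f.coeff w ≠ 0 := fun w => by
    rw [← Finsupp.mem_support_iff, hf]
    exact w.2
  have hz0 : eval f z = 0 := hz
  rw [eval_eq_sum hf] at hz0
  have hval := fun w : I => val_term (v := v) (hc w) (z := z) (fun _ => rfl) w
  have : Nonempty I := hI.to_subtype
  obtain ⟨α, hα⟩ := Finite.exists_max fun w : I =>
    WithZero.log (v (f.coeff w)) + dot w fun j => WithZero.log (v (z j))
  by_contra hT
  have hlt : ∀ w : I, w ≠ α → v (f.coeff w * ∏ j, (z j : K) ^ (w : Fin k → ℤ) j) <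
      v (f.coeff α * ∏ j, (z j : K) ^ (α : Fin k → ℤ) j) := fun w hw => by
    rw [hval, hval, WithZero.exp_lt_exp]
    exact lt_of_le_of_ne (hα w) fun h => hT ⟨α, w, hw.symm, h.symm, hα⟩
  have := v.map_sum_eq_of_lt (s := Finset.univ)
    (f := fun w : I => f.coeff w * ∏ j, (z j : K) ^ (w : Fin k → ℤ) j) (Finset.mem_univ α)
    (fun w hw => hlt w (by simpa using hw))
  rw [hz0, hval, map_zero] at this
  exact WithZero.exp_ne_zero this.symm

/-- Choose `t` with `Val t = x` and restrict `f` to the curve `z_j = t_j s ^ u_j`, where `u`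
separates the points of `I`. No two monomials merge, so the restriction is a univariate polynomial
with two coefficients of maximal valuation. A root `s` of valuation `1` gives a zero of `f` over
`x`. -/
theorem mem_amoeba_of_twiceMax [IsAlgClosed K] (hv : Function.Surjective v)
    {I : Finset (Fin k → ℤ)} {f : K[Fin k → ℤ]}
    (hf : f.coeff.support = I) {x : Fin k → ℝ}
    (hx : TwiceMax fun w : I => WithZero.log (v (f.coeff w)) + dot w x) :
    x ∈ amoeba (fun a => WithZero.log (v a)) f := by
  classical
  have hc : ∀ w : I, f.coeff w ≠ 0 := fun w => by
    rw [← Finsupp.mem_support_iff, hf]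
    exact w.2
  obtain ⟨u, hu⟩ := exists_injOn_dot I
  have ht : ∀ j, ∃ t : Kˣ, WithZero.log (v t) = x j := fun j => by
    obtain ⟨t, ht⟩ := hv (WithZero.exp (x j))
    have : t ≠ 0 := (Valuation.ne_zero_iff v).1 (ht ▸ WithZero.exp_ne_zero)
    exact ⟨Units.mk0 t this, by simp [ht]⟩
  choose t ht using ht
  have hval := fun w : I => val_term (v := v) (hc w) (z := t) ht w
  let d : I → ℤ := fun w => ∑ j, (w : Fin k → ℤ) j * u j
  -- The shift by `m` makes the exponents natural numbers; it is undone by the factor `s ^ (-m)`,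
  -- which does not affect zeros.
  obtain ⟨m, hm⟩ : ∃ m : ℤ, ∀ w, 0 ≤ d w + m := by
    obtain ⟨b, hb⟩ := (Set.finite_range d).bddBelow
    exact ⟨-b, fun w => by have := hb ⟨w, rfl⟩; linarith⟩
  let e : I → ℕ := fun w => (d w + m).toNat
  have he : Function.Injective e := fun w w' h => by
    have h1 : d w = d w' := by
      have := hm w
      have := hm w'
      simp only [e] at h
      omega
    exact Subtype.ext (hu w.2 w'.2 h1)
  let b : I → K := fun w => f.coeff w * ∏ j, (t j : K) ^ (w : Fin k → ℤ) j
  let p : K[X] := ∑ w : I, monomial (e w) (b w)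
  have hp : ∀ w, p.coeff (e w) = b w := fun w => by
    simp [p, coeff_monomial, he.eq_iff]
  obtain ⟨α, β, hne, hαβ, hmax⟩ := hx
  obtain ⟨s, hs1, hs⟩ := exists_root_of_two_max (v := v) (p := p) (i := e α) (j := e β)
    (fun h => hne (he h)) (by
      rw [hp, ← Valuation.ne_zero_iff v, hval]
      exact WithZero.exp_ne_zero) (by
      rw [hp, hp, hval, hval]
      exact congrArg _ hαβ) (fun l => by
      rw [hp]
      by_cases hl : ∃ w, e w = l
      · obtain ⟨w, rfl⟩ := hl
        rw [hp, hval, hval, WithZero.exp_le_exp]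
        exact hmax w
      · have : p.coeff l = 0 := by
          simp only [p, finsetSum_coeff, coeff_monomial]
          exact Finset.sum_eq_zero fun w _ => if_neg fun h => hl ⟨w, h⟩
        rw [this, map_zero]
        exact zero_le)
  have hs0 : s ≠ 0 := (Valuation.ne_zero_iff v).1 (hs1 ▸ one_ne_zero)
  refine ⟨fun j => t j * Units.mk0 s hs0 ^ u j, ?_, ?_⟩
  · change eval f _ = 0
    rw [eval_eq_sum hf]
    have hterm : ∀ w : I, f.coeff w * ∏ j, ((t j * Units.mk0 s hs0 ^ u j : Kˣ) : K) ^
        (w : Fin k → ℤ) j = s ^ (-m) * (b w * s ^ e w) := fun w => by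
      have h1 : s ^ (-m) * s ^ e w = s ^ d w := by
        rw [← zpow_natCast, ← zpow_add₀ hs0]
        congr 1
        have := hm w
        simp only [e]
        omega
      rw [mul_left_comm, h1, mul_assoc]
      congr 1
      have h2 : ∏ j, (s ^ u j) ^ (w : Fin k → ℤ) j = s ^ d w := by
        have h3 : ∀ S : Finset (Fin k), ∏ j ∈ S, (s ^ u j) ^ (w : Fin k → ℤ) j =
            s ^ ∑ j ∈ S, (w : Fin k → ℤ) j * u j := fun S => by
          induction S using Finset.induction_on with
          | empty => simp
          | insert j S hj ih =>
            rw [Finset.prod_insert hj, Finset.sum_insert hj, zpow_add₀ hs0, ih, ← zpow_mul,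
              mul_comm (u j)]
        exact h3 _
      rw [← h2, ← Finset.prod_mul_distrib]
      exact Finset.prod_congr rfl fun j _ => by simp [mul_zpow]
    rw [Finset.sum_congr rfl fun w _ => hterm w, ← Finset.mul_sum]
    have : ∑ w, b w * s ^ e w = p.eval s := by simp [p, eval_finsetSum]
    rw [this, hs, mul_zero]
  · funext j
    have : v (t j) ≠ 0 := (Valuation.ne_zero_iff v).2 (t j).ne_zero
    simp [hs1, ht]

/-- Surjectivity of `v` lifts a tropical solution to coefficients. The valuations of the
coefficients of any competitor solve the same system, hence differ by a constant and define the same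
tropical hypersurface. -/
theorem existsUnique_amoeba [IsAlgClosed K] (hv : Function.Surjective v) {n : ℕ}
    {I : Finset (Fin k → ℤ)} (hI : I.card = n + 1) {x : Fin n → Fin k → ℝ}
    (hx : ∀ (a : I → ℝ) (α β : Fin n → I), (∀ i, α i ≠ β i) →
      (∀ i, a (α i) + dot (α i) (x i) = a (β i) + dot (β i) (x i)) → Indep α β) :
    ∃! A : Set (Fin k → ℝ), A ∈ amoebas (fun a => WithZero.log (v a)) I ∧ ∀ i, x i ∈ A := by
  classical
  have hne : I.Nonempty := Finset.card_pos.1 (by omega)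
  have hc : Fintype.card I = n + 1 := by simpa using hI
  obtain ⟨a, ha⟩ := exists_forall_twiceMax hc fun i (w : I) => dot w (x i)
  have hcoef : ∀ w : I, ∃ c : K, c ≠ 0 ∧ WithZero.log (v c) = a w := fun w => by
    obtain ⟨c, hc⟩ := hv (WithZero.exp (a w))
    exact ⟨c, (Valuation.ne_zero_iff v).1 (hc ▸ WithZero.exp_ne_zero), by simp [hc]⟩
  choose c hc0 hca using hcoef
  let f : K[Fin k → ℤ] := .ofCoeff (Finsupp.onFinset I
    (fun w => if h : w ∈ I then c ⟨w, h⟩ else 0) fun w hw => by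
      by_contra h
      simp [h] at hw)
  have hfc : ∀ w : I, f.coeff w = c w := fun w => by simp [f]
  have hf : f.coeff.support = I := by
    ext w
    rw [Finsupp.mem_support_iff]
    refine ⟨fun h => ?_, fun h => by rw [hfc ⟨w, h⟩]; exact hc0 _⟩
    by_contra hw
    simp [f, hw] at h
  have hfa : ∀ w : I, WithZero.log (v (f.coeff w)) = a w := fun w => by rw [hfc, hca]
  refine ⟨amoeba (fun a => WithZero.log (v a)) f, ⟨⟨f, hf, rfl⟩, fun i => ?_⟩, ?_⟩
  · refine mem_amoeba_of_twiceMax hv hf ?_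
    simp only [hfa]
    exact ha i
  · rintro _ ⟨⟨g, hg, rfl⟩, hgx⟩
    obtain ⟨C, hC⟩ := sub_const hc hx (fun i => twiceMax_of_mem_amoeba hne hg (hgx i)) ha
    have key : ∀ y : Fin k → ℝ, (TwiceMax fun w : I => WithZero.log (v (g.coeff w)) + dot w y) ↔
        TwiceMax fun w : I => WithZero.log (v (f.coeff w)) + dot w y := fun y => by
      simp only [hC, hfa]
      constructor <;> rintro ⟨α, β, h1, h2, h3⟩ <;>
        exact ⟨α, β, h1, by linarith, fun γ => by linarith [h3 γ]⟩
    ext y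
    constructor
    · exact fun h => mem_amoeba_of_twiceMax hv hf ((key y).1 (twiceMax_of_mem_amoeba hne hg h))
    · exact fun h => mem_amoeba_of_twiceMax hv hg ((key y).2 (twiceMax_of_mem_amoeba hne hf h))

end NonArchAmoeba

/-! ### A fixed point theorem for convergent Puiseux series -/

namespace ConvPuiseux

open scoped ENNReal

/-- All exponents of `x` are at least `c`. -/
def OrdGE (c : ℝ) (x : HahnSeries ℝ ℂ) : Prop :=
  ∀ τ, x.coeff τ ≠ 0 → c ≤ τ

theorem OrdGE.mono {c d : ℝ} {x : HahnSeries ℝ ℂ} (h : OrdGE d x) (hcd : c ≤ d) : OrdGE c x :=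
  fun τ hτ => hcd.trans (h τ hτ)

theorem ordGE_zero (c : ℝ) : OrdGE c 0 := fun τ hτ => by simp at hτ

theorem ordGE_single (c : ℝ) (z : ℂ) : OrdGE c (HahnSeries.single c z) := fun τ hτ => by
  by_contra h
  exact hτ (HahnSeries.coeff_single_of_ne fun h' => h h'.ge)

theorem ordGE_one : OrdGE 0 1 := ordGE_single 0 1

theorem OrdGE.add {c : ℝ} {x y : HahnSeries ℝ ℂ} (hx : OrdGE c x) (hy : OrdGE c y) :
    OrdGE c (x + y) := fun τ hτ => by
  by_contra h
  refine hτ ?_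
  rw [HahnSeries.coeff_add, of_not_not (mt (hx τ) h), of_not_not (mt (hy τ) h), add_zero]

theorem OrdGE.neg {c : ℝ} {x : HahnSeries ℝ ℂ} (hx : OrdGE c x) : OrdGE c (-x) := fun τ hτ =>
  hx τ (by simpa using hτ)

theorem OrdGE.mul {c d : ℝ} {x y : HahnSeries ℝ ℂ} (hx : OrdGE c x) (hy : OrdGE d y) :
    OrdGE (c + d) (x * y) := fun τ hτ => by
  obtain ⟨a, ha, b, hb, rfl⟩ := HahnSeries.support_mul_subset (show τ ∈ (x * y).support from hτ)
  exact add_le_add (hx a ha) (hy b hb)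

theorem OrdGE.pow {x : HahnSeries ℝ ℂ} (hx : OrdGE 0 x) (n : ℕ) : OrdGE 0 (x ^ n) := by
  induction n with
  | zero => exact ordGE_one
  | succ n ih => simpa [pow_succ] using ih.mul hx

theorem OrdGE.sum {ι : Type*} {c : ℝ} {s : Finset ι} {f : ι → HahnSeries ℝ ℂ}
    (h : ∀ i ∈ s, OrdGE c (f i)) : OrdGE c (∑ i ∈ s, f i) :=
  Finset.sum_induction f (OrdGE c) (fun _ _ => OrdGE.add) (ordGE_zero c) h

theorem OrdGE.pow_sub_pow {c : ℝ} {x y : HahnSeries ℝ ℂ} (hx : OrdGE 0 x) (hy : OrdGE 0 y)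
    (h : OrdGE c (x - y)) (n : ℕ) : OrdGE c (x ^ n - y ^ n) := by
  induction n with
  | zero => simpa using ordGE_zero c
  | succ n ih =>
    have h1 : x ^ (n + 1) - y ^ (n + 1) = x * (x ^ n - y ^ n) + (x - y) * y ^ n := by ring
    have h2 := hx.mul ih
    have h3 := h.mul (hy.pow n)
    rw [zero_add] at h2
    rw [add_zero] at h3
    exact h1 ▸ h2.add h3

theorem ordGE_order (x : HahnSeries ℝ ℂ) : OrdGE x.order x := fun _ hτ =>
  HahnSeries.order_le_of_coeff_ne_zero hτ

/-- The weighted norm `∑ |c_τ| t ^ τ`. -/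
noncomputable def wnorm (t : ℝ) (x : HahnSeries ℝ ℂ) : ℝ≥0∞ :=
  ∑' τ : ℝ, ENNReal.ofReal (‖x.coeff τ‖ * t ^ τ)

theorem wnorm_ne_top_iff {t : ℝ} (ht : 0 < t) {x : HahnSeries ℝ ℂ} :
    wnorm t x ≠ ⊤ ↔ Summable fun τ : ℝ => ‖x.coeff τ‖ * t ^ τ := by
  refine ⟨fun h => ?_, fun h => h.tsum_ofReal_ne_top⟩
  have := ENNReal.summable_toReal h
  exact this.congr fun τ => ENNReal.toReal_ofReal (by positivity)

theorem wnorm_add_le {t : ℝ} (ht : 0 < t) (x y : HahnSeries ℝ ℂ) :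
    wnorm t (x + y) ≤ wnorm t x + wnorm t y := by
  rw [wnorm, wnorm, wnorm, ← ENNReal.tsum_add]
  refine ENNReal.tsum_le_tsum fun τ => ?_
  rw [← ENNReal.ofReal_add (by positivity) (by positivity), ← add_mul, HahnSeries.coeff_add]
  refine ENNReal.ofReal_le_ofReal ?_
  gcongr
  exact norm_add_le _ _

theorem wnorm_zero (t : ℝ) : wnorm t 0 = 0 := by simp [wnorm]

theorem wnorm_one (t : ℝ) : wnorm t 1 = 1 := by
  rw [wnorm, tsum_eq_single 0 fun τ hτ => by simp [HahnSeries.coeff_one, hτ]]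
  simp [HahnSeries.coeff_one]

theorem wnorm_mul_le {t : ℝ} (ht : 0 < t) (x y : HahnSeries ℝ ℂ) :
    wnorm t (x * y) ≤ wnorm t x * wnorm t y := by
  let F : ℝ → ℝ≥0∞ := fun τ => ENNReal.ofReal (‖x.coeff τ‖ * t ^ τ)
  let G : ℝ → ℝ≥0∞ := fun τ => ENNReal.ofReal (‖y.coeff τ‖ * t ^ τ)
  have h1 : ∀ τ, ENNReal.ofReal (‖(x * y).coeff τ‖ * t ^ τ) ≤ ∑' σ, F σ * G (τ - σ) := fun τ => by
    rw [HahnSeries.coeff_mul]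
    set A := Finset.antidiagonal x.isPWO_support y.isPWO_support τ with hA
    have hinj : Set.InjOn (Prod.fst : ℝ × ℝ → ℝ) (A : Set (ℝ × ℝ)) := by
      intro p hp q hq h
      have h1 := (Finset.mem_antidiagonal.1 hp).2.2
      have h2 := (Finset.mem_antidiagonal.1 hq).2.2
      ext
      · exact h
      · linarith
    calc ENNReal.ofReal (‖∑ p ∈ A, x.coeff p.1 * y.coeff p.2‖ * t ^ τ)
        ≤ ENNReal.ofReal (∑ p ∈ A, ‖x.coeff p.1‖ * t ^ p.1 * (‖y.coeff p.2‖ * t ^ p.2)) := by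
          refine ENNReal.ofReal_le_ofReal ?_
          calc ‖∑ p ∈ A, x.coeff p.1 * y.coeff p.2‖ * t ^ τ
              ≤ (∑ p ∈ A, ‖x.coeff p.1 * y.coeff p.2‖) * t ^ τ := by
                gcongr
                exact norm_sum_le _ _
            _ = _ := by
                rw [Finset.sum_mul]
                refine Finset.sum_congr rfl fun p hp => ?_
                rw [norm_mul, ← (Finset.mem_antidiagonal.1 hp).2.2, Real.rpow_add ht]
                ring
      _ = ∑ p ∈ A, F p.1 * G (τ - p.1) := by
          rw [ENNReal.ofReal_sum_of_nonneg fun _ _ => by positivity]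
          refine Finset.sum_congr rfl fun p hp => ?_
          have h2 : τ - p.1 = p.2 := by linarith [(Finset.mem_antidiagonal.1 hp).2.2]
          rw [h2, ENNReal.ofReal_mul (by positivity)]
      _ = ∑ σ ∈ A.image Prod.fst, F σ * G (τ - σ) :=
          (Finset.sum_image (f := fun σ => F σ * G (τ - σ)) hinj).symm
      _ ≤ _ := ENNReal.sum_le_tsum _
  calc wnorm t (x * y) ≤ ∑' τ, ∑' σ, F σ * G (τ - σ) := ENNReal.tsum_le_tsum h1
    _ = ∑' σ, F σ * ∑' τ, G (τ - σ) := by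
        rw [ENNReal.tsum_comm]
        exact tsum_congr fun σ => ENNReal.tsum_mul_left
    _ = ∑' σ, F σ * wnorm t y := tsum_congr fun σ => by
        exact congrArg _ ((Equiv.subRight σ).tsum_eq G)
    _ = _ := ENNReal.tsum_mul_right

theorem wnorm_pow_le {t : ℝ} (ht : 0 < t) (x : HahnSeries ℝ ℂ) (n : ℕ) :
    wnorm t (x ^ n) ≤ wnorm t x ^ n := by
  induction n with
  | zero => simp [wnorm_one]
  | succ n ih =>
    rw [pow_succ, pow_succ]
    exact (wnorm_mul_le ht _ _).trans (by gcongr)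

theorem wnorm_sum_le {ι : Type*} {t : ℝ} (ht : 0 < t) (s : Finset ι) (f : ι → HahnSeries ℝ ℂ) :
    wnorm t (∑ i ∈ s, f i) ≤ ∑ i ∈ s, wnorm t (f i) :=
  Finset.le_sum_of_subadditive _ (wnorm_zero t).le (wnorm_add_le ht) _ _

theorem tendsto_wnorm {u : HahnSeries ℝ ℂ} (hu : IsConvergent u)
    (hpos : ∀ τ ∈ u.support, 0 < τ) : Tendsto (fun t => wnorm t u) (𝓝[>] 0) (𝓝 0) := by
  rw [ENNReal.tendsto_nhds_zero]
  intro ε hε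
  obtain ⟨r, hr0, hr⟩ := ENNReal.lt_iff_exists_real_btwn.1 hε
  have hr1 : 0 < r := ENNReal.ofReal_pos.1 hr.1
  -- Scaling by `1 / (2 * r)` turns the available bound `1 / 2` into the bound `r`.
  have h1 := eventually_tsum_le_half (u := HahnSeries.single 0 ((1 / (2 * r) : ℝ) : ℂ) * u)
    ((isConvergent_single _ _).mul hu) fun τ hτ => hpos τ fun h => hτ (by
      rw [HahnSeries.coeff_single_zero_mul, h, mul_zero])
  filter_upwards [h1, hu.2, self_mem_nhdsWithin] with t h1 h2 ht
  have ht : 0 < t := ht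
  rw [wnorm, ← ENNReal.ofReal_tsum_of_nonneg (fun τ => by positivity) h2]
  refine le_trans (ENNReal.ofReal_le_ofReal ?_) hr.2.le
  simp only [HahnSeries.coeff_single_zero_mul, norm_mul, Complex.norm_real, mul_assoc] at h1
  rw [tsum_mul_left, Real.norm_of_nonneg (by positivity), div_mul_eq_mul_div, one_mul,
    div_le_div_iff₀ (by positivity) two_pos] at h1
  linarith

/-- The series with exponents in `Γ`. -/
def suppSubring (Γ : AddSubmonoid ℝ) : Subring (HahnSeries ℝ ℂ) where
  carrier := {x | ∀ τ, x.coeff τ ≠ 0 → τ ∈ Γ}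
  mul_mem' {x y} hx hy τ hτ := by
    obtain ⟨a, ha, b, hb, rfl⟩ := HahnSeries.support_mul_subset (show τ ∈ (x * y).support from hτ)
    exact Γ.add_mem (hx a ha) (hy b hb)
  one_mem' τ hτ := by
    by_contra h
    exact hτ (by rw [HahnSeries.coeff_one, if_neg fun h0 : τ = 0 => h (h0 ▸ Γ.zero_mem)])
  add_mem' {x y} hx hy τ hτ := by
    by_contra h
    exact hτ (by rw [HahnSeries.coeff_add, of_not_not (mt (hx τ) h), of_not_not (mt (hy τ) h),
      add_zero])
  zero_mem' τ hτ := by simp at hτ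
  neg_mem' {x} hx τ hτ := hx τ (by simpa using hτ)

theorem inSum_biUnion (d : ℕ) (S : ℕ → Set ℝ) (h : ∀ i < d, InSumOfProgressions (S i)) :
    InSumOfProgressions (⋃ i ∈ Finset.range d, S i) := by
  induction d with
  | zero => exact inSum_mono (by simp) (inSum_singleton 0)
  | succ d ih =>
    rw [Finset.range_add_one, Finset.set_biUnion_insert]
    exact inSum_union (h d (by simp)) (ih fun i hi => h i (by omega))

/-- Some finite set of positive steps generates all exponents of finitely many series with positive
exponents, and these exponents are bounded away from `0`. -/
theorem exists_steps {d : ℕ} {u : ℕ → HahnSeries ℝ ℂ} (hu : ∀ i < d, IsConvergent (u i))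
    (hpos : ∀ i < d, ∀ τ ∈ (u i).support, 0 < τ) :
    ∃ (D : Finset ℝ) (δ : ℝ), (∀ a ∈ D, 0 < a) ∧ 0 < δ ∧ ∀ i < d,
      u i ∈ suppSubring (AddSubmonoid.closure (D : Set ℝ)) ∧ OrdGE δ (u i) := by
  obtain ⟨D, hD, hsub⟩ := inSum_pos (inSum_biUnion d (fun i => (u i).support) fun i hi => (hu i hi).1)
    (fun τ hτ => by
      obtain ⟨i, hi, hτ⟩ := Set.mem_iUnion₂.1 hτ
      exact hpos i (Finset.mem_range.1 hi) τ hτ)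
  obtain ⟨δ, hδ, hδD⟩ : ∃ δ : ℝ, 0 < δ ∧ ∀ a ∈ D, δ ≤ a := by
    rcases D.eq_empty_or_nonempty with rfl | hne
    · exact ⟨1, one_pos, by simp⟩
    · obtain ⟨a, ha, hmin⟩ := D.exists_min_image id hne
      exact ⟨a, hD a ha, hmin⟩
  have hΓ : ∀ s ∈ AddSubmonoid.closure (D : Set ℝ), s = 0 ∨ δ ≤ s := fun s hs => by
    induction hs using AddSubmonoid.closure_induction with
    | mem x hx => exact Or.inr (hδD x hx)
    | zero => exact Or.inl rfl
    | add x y _ _ hx hy => grind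
  have hmem : ∀ i < d, ∀ τ, (u i).coeff τ ≠ 0 → τ ∈ AddSubmonoid.closure (D : Set ℝ) :=
    fun i hi τ hτ => hsub (Set.mem_iUnion₂.2 ⟨i, Finset.mem_range.2 hi, hτ⟩)
  exact ⟨D, δ, hD, hδ, fun i hi => ⟨hmem i hi, fun τ hτ =>
    (hΓ τ (hmem i hi τ hτ)).resolve_left (hpos i hi τ hτ).ne'⟩⟩

/-- The equation `y = 1 + ∑ u_i y ^ (i + 2)` is solvable if all `u_i` have positive exponents. -/
theorem exists_fixed_point {d : ℕ} {u : ℕ → HahnSeries ℝ ℂ} (hu : ∀ i < d, IsConvergent (u i))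
    (hpos : ∀ i < d, ∀ τ ∈ (u i).support, 0 < τ) :
    ∃ y, IsConvergent y ∧ OrdGE 0 y ∧ y = 1 + ∑ i ∈ Finset.range d, u i * y ^ (i + 2) := by
  obtain ⟨D, δ, hD, hδ, hDu⟩ := exists_steps hu hpos
  obtain ⟨Φ, hΦdef⟩ : ∃ Φ : HahnSeries ℝ ℂ → HahnSeries ℝ ℂ, ∀ y,
    Φ y = 1 + ∑ i ∈ Finset.range d, u i * y ^ (i + 2) := ⟨_, fun _ => rfl⟩
  obtain ⟨s, hs00, hs⟩ : ∃ s : ℕ → HahnSeries ℝ ℂ, s 0 = 0 ∧ ∀ j, s (j + 1) = Φ (s j) :=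
    ⟨fun j => Φ^[j] 0, rfl, fun j => Function.iterate_succ_apply' Φ j 0⟩
  have hsΓ : ∀ j, s j ∈ suppSubring (AddSubmonoid.closure (D : Set ℝ)) := fun j => by
    induction j with
    | zero => exact hs00 ▸ zero_mem _
    | succ j ih =>
      rw [hs, hΦdef]
      exact add_mem (one_mem _) (sum_mem fun i hi =>
        mul_mem (hDu i (Finset.mem_range.1 hi)).1 (pow_mem ih _))
  have hs0 : ∀ j, OrdGE 0 (s j) := fun j τ hτ => closure_nonneg hD (hsΓ j τ hτ)
  -- `Φ` is a contraction for the order: every `u i` contributes at least `δ`.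
  have hΦ : ∀ x y c, OrdGE 0 x → OrdGE 0 y → OrdGE c (x - y) → OrdGE (δ + c) (Φ x - Φ y) := by
    intro x y c hx hy h
    have : Φ x - Φ y = ∑ i ∈ Finset.range d, u i * (x ^ (i + 2) - y ^ (i + 2)) := by
      simp only [hΦdef, mul_sub, Finset.sum_sub_distrib]
      ring
    rw [this]
    exact OrdGE.sum fun i hi => (hDu i (Finset.mem_range.1 hi)).2.mul (hx.pow_sub_pow hy h _)
  have hstep : ∀ j : ℕ, OrdGE (j * δ) (s (j + 1) - s j) := fun j => by
    induction j with
    | zero => simpa [hs00] using hs0 1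
    | succ j ih =>
      have := hΦ _ _ _ (hs0 _) (hs0 _) ih
      rw [← hs, ← hs] at this
      refine this.mono ?_
      push_cast
      linarith
  have hstab : ∀ (τ : ℝ) (i j : ℕ), i ≤ j → τ < i * δ → (s j).coeff τ = (s i).coeff τ := by
    intro τ i j hij hτ
    induction j, hij using Nat.le_induction with
    | base => rfl
    | succ j hij ih =>
      rw [← ih, ← sub_eq_zero, ← HahnSeries.coeff_sub]
      by_contra h
      have h1 := hstep j τ h
      have h2 : (i : ℝ) * δ ≤ j * δ := by gcongr
      linarith
  have harch : ∀ τ : ℝ, ∃ j : ℕ, τ < j * δ := fun τ => by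
    obtain ⟨j, hj⟩ := exists_nat_gt (τ / δ)
    exact ⟨j, (div_lt_iff₀ hδ).1 hj⟩
  choose J hJ using harch
  have hmem : ∀ τ, (s (J τ)).coeff τ ≠ 0 → τ ∈ AddSubmonoid.closure (D : Set ℝ) :=
    fun τ hτ => hsΓ _ τ hτ
  -- The coefficient of the limit at `τ` is read off at stage `J τ`, after which it no longer
  -- changes. The common exponent monoid makes the support well ordered.
  obtain ⟨y, hyJ⟩ : ∃ y : HahnSeries ℝ ℂ, ∀ τ, y.coeff τ = (s (J τ)).coeff τ :=
    ⟨⟨fun τ => (s (J τ)).coeff τ, (Set.IsPWO.addSubmonoid_closure (fun x hx => (hD x hx).le)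
      D.finite_toSet.isPWO).mono hmem⟩, fun _ => rfl⟩
  simp only [← hyJ] at hmem
  have hy : ∀ (τ : ℝ) (j : ℕ), τ < j * δ → y.coeff τ = (s j).coeff τ := fun τ j hj => by
    rw [hyJ]
    rcases le_total (J τ) j with h | h
    · exact (hstab τ _ _ h (hJ τ)).symm
    · exact hstab τ _ _ h hj
  have hy0 : OrdGE 0 y := fun τ hτ => closure_nonneg hD (hmem τ hτ)
  have hys : ∀ j : ℕ, OrdGE (j * δ) (y - s j) := fun j τ hτ => by
    by_contra h
    exact hτ (by rw [HahnSeries.coeff_sub, hy τ j (not_le.1 h), sub_self])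
  refine ⟨y, ⟨(inSum_iff _).2 ⟨0, D, hD, fun τ hτ => by simpa using hmem τ hτ⟩, ?_⟩, hy0, ?_⟩
  -- For small `t` this sum is at most `1`, so `Φ` maps the ball `wnorm t ≤ 2` into itself and all
  -- iterates stay there.
  · have hlim : Tendsto (fun t => ∑ i ∈ Finset.range d, wnorm t (u i) * 2 ^ (i + 2)) (𝓝[>] 0)
        (𝓝 0) := by
      have := tendsto_finsetSum (Finset.range d) fun i hi =>
        ENNReal.Tendsto.mul_const (b := 2 ^ (i + 2)) (tendsto_wnorm
          (hu i (Finset.mem_range.1 hi)) (hpos i (Finset.mem_range.1 hi))) (Or.inr (by simp))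
      simpa using this
    filter_upwards [hlim.eventually_le_const one_pos, self_mem_nhdsWithin] with t h1 ht
    have ht : 0 < t := ht
    have hbound : ∀ j, wnorm t (s j) ≤ 2 := fun j => by
      induction j with
      | zero => simp [hs00, wnorm_zero]
      | succ j ih =>
        rw [hs, hΦdef]
        calc wnorm t (1 + ∑ i ∈ Finset.range d, u i * s j ^ (i + 2))
            ≤ wnorm t 1 + ∑ i ∈ Finset.range d, wnorm t (u i * s j ^ (i + 2)) :=
              (wnorm_add_le ht _ _).trans (by gcongr; exact wnorm_sum_le ht _ _)
          _ ≤ 1 + ∑ i ∈ Finset.range d, wnorm t (u i) * 2 ^ (i + 2) := by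
              rw [wnorm_one]
              gcongr with i
              refine (wnorm_mul_le ht _ _).trans ?_
              gcongr
              exact (wnorm_pow_le ht _ _).trans (by gcongr)
          _ ≤ 1 + 1 := by gcongr
          _ = 2 := one_add_one_eq_two
    refine (wnorm_ne_top_iff ht).1 (ne_top_of_le_ne_top ENNReal.ofNat_ne_top (b := 2) ?_)
    rw [wnorm, ENNReal.tsum_eq_iSup_sum]
    refine iSup_le fun F => ?_
    -- On a finite set of exponents the limit agrees with one iterate, so the bound passes to every
    -- partial sum.
    obtain ⟨j, hj⟩ : ∃ j : ℕ, ∀ τ ∈ F, τ < j * δ := by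
      obtain ⟨B, hB⟩ := F.finite_toSet.bddAbove
      exact ⟨J B, fun τ hτ => (hB hτ).trans_lt (hJ B)⟩
    rw [Finset.sum_congr rfl fun τ hτ => by rw [hy τ j (hj τ hτ)]]
    exact (ENNReal.sum_le_tsum F).trans (hbound j)
  · rw [← hΦdef, ← sub_eq_zero]
    ext τ
    by_contra hτ
    -- Both differences have all exponents at least `J τ * δ`, which exceeds `τ`.
    have h1 : y - Φ y = (y - s (J τ + 1)) - (Φ y - Φ (s (J τ))) := by rw [hs]; ring
    have h2 : OrdGE (J τ * δ) (y - Φ y) := by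
      rw [h1, sub_eq_add_neg]
      refine ((hys _).mono ?_).add ((hΦ _ _ _ hy0 (hs0 _) (hys _)).mono ?_).neg
      · push_cast
        linarith
      · linarith
    exact (hJ τ).not_ge (h2 τ (by simpa using hτ))

end ConvPuiseux

/-! ### The field of convergent Puiseux series is algebraically closed -/

namespace ConvPuiseux

open Polynomial

/-! ### The valuation ring, its residue map and Hensel's lemma -/

/-- The valuation ring: convergent Puiseux series without negative exponents. -/
def integers : Subring (HahnSeries ℝ ℂ) where
  carrier := {b | IsConvergent b ∧ OrdGE 0 b}
  mul_mem' hx hy := ⟨hx.1.mul hy.1, by simpa using hx.2.mul hy.2⟩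
  one_mem' := ⟨isConvergent_single 0 1, ordGE_one⟩
  add_mem' hx hy := ⟨hx.1.add hy.1, hx.2.add hy.2⟩
  zero_mem' := ⟨by simpa using isConvergent_single 0 0, ordGE_zero 0⟩
  neg_mem' hx := ⟨hx.1.neg, hx.2.neg⟩

theorem coeff_zero_mul {x y : HahnSeries ℝ ℂ} (hx : OrdGE 0 x) (hy : OrdGE 0 y) :
    (x * y).coeff 0 = x.coeff 0 * y.coeff 0 := by
  rw [HahnSeries.coeff_mul]
  refine Finset.sum_eq_single (0, 0) (fun p hp hne => ?_) fun h => ?_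
  · obtain ⟨h1, h2, h3⟩ := Finset.mem_antidiagonal.1 hp
    have h1 := hx _ h1
    have h2 := hy _ h2
    exact absurd (Prod.ext (by simp; linarith) (by simp; linarith)) hne
  · by_contra h0
    exact h (Finset.mem_antidiagonal.2 ⟨left_ne_zero_of_mul h0, right_ne_zero_of_mul h0, add_zero 0⟩)

/-- The residue map `b ↦ b(0)`. -/
def residue : integers →+* ℂ where
  toFun b := (b : HahnSeries ℝ ℂ).coeff 0
  map_one' := by simp [HahnSeries.coeff_one]
  map_mul' x y := coeff_zero_mul x.2.2 y.2.2
  map_zero' := rfl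
  map_add' _ _ := rfl

theorem residue_apply (b : integers) : residue b = (b : HahnSeries ℝ ℂ).coeff 0 := rfl

/-- The constant series. -/
noncomputable def const (z : ℂ) : integers :=
  ⟨HahnSeries.single 0 z, isConvergent_single 0 z, ordGE_single 0 z⟩

theorem residue_const (z : ℂ) : residue (const z) = z := by simp [residue_apply, const]

theorem pos_of_residue_eq_zero {b : integers} (h : residue b = 0) :
    ∀ τ ∈ (b : HahnSeries ℝ ℂ).support, 0 < τ := fun τ hτ =>
  lt_of_le_of_ne (b.2.2 τ hτ) fun h0 => hτ (h0 ▸ h)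

/-- A nonzero constant term makes the order at most `0`, so the inverse has order at least `0` and
lies in the ring. -/
theorem exists_mul_eq_one {b : integers} (h : residue b ≠ 0) : ∃ e, b * e = 1 := by
  have hb : (b : HahnSeries ℝ ℂ) ≠ 0 := HahnSeries.ne_zero_of_coeff_ne_zero h
  have h1 : (b : HahnSeries ℝ ℂ) * (b : HahnSeries ℝ ℂ)⁻¹ = 1 := mul_inv_cancel₀ hb
  have h2 : (b : HahnSeries ℝ ℂ).order ≤ 0 := HahnSeries.order_le_of_coeff_ne_zero h
  have h3 := HahnSeries.order_mul hb (inv_ne_zero hb)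
  rw [h1, HahnSeries.order_one] at h3
  exact ⟨⟨_, b.2.1.inv, (ordGE_order _).mono (by linarith)⟩, Subtype.ext h1⟩

/-- The power `t ^ a`. -/
noncomputable def tpow (a : ℝ) (ha : 0 ≤ a) : integers :=
  ⟨HahnSeries.single a 1, isConvergent_single a 1, (ordGE_single a 1).mono ha⟩

theorem coe_tpow_pow (a : ℝ) (ha : 0 ≤ a) (n : ℕ) :
    ((tpow a ha ^ n : integers) : HahnSeries ℝ ℂ) = HahnSeries.single (n * a) 1 := by
  simp [tpow, HahnSeries.single_pow]

theorem exists_eq_tpow_pow_mul {a : ℝ} (ha : 0 ≤ a) (n : ℕ) {b : integers}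
    (h : OrdGE (n * a) (b : HahnSeries ℝ ℂ)) :
    ∃ e, b = tpow a ha ^ n * e ∧ residue e = (b : HahnSeries ℝ ℂ).coeff (n * a) := by
  refine ⟨⟨HahnSeries.single (-(n * a)) 1 * (b : HahnSeries ℝ ℂ),
    (isConvergent_single _ _).mul b.2.1,
    ((ordGE_single (-(n * a)) 1).mul h).mono (by linarith)⟩, Subtype.ext ?_, ?_⟩
  · rw [Subring.coe_mul, coe_tpow_pow, ← mul_assoc, HahnSeries.single_mul_single]
    simp
  · rw [residue_apply, HahnSeries.coeff_single_mul]
    simp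

/-- Hensel's lemma. -/
theorem exists_root_of_simple {P : integers[X]} (h0 : residue (P.coeff 0) = 0)
    (h1 : residue (P.coeff 1) ≠ 0) : ∃ s, P.eval s = 0 ∧ residue s = 0 := by
  obtain ⟨e, he⟩ := exists_mul_eq_one h1
  -- With `g = -P_0 / P_1`, the substitution `s = g y` turns `P(s) = 0` into `y = 1 + ∑ u_i y ^ (i +
  -- 2)`. Every `u_i` contains the factor `g`, hence has positive exponents.
  let g : integers := -(e * P.coeff 0)
  have hg : residue g = 0 := by simp [g, h0]
  let u : ℕ → integers := fun i => -(e * P.coeff (i + 2) * g ^ (i + 1))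
  have hu : ∀ i, residue (u i) = 0 := fun i => by simp [u, hg]
  obtain ⟨y, hy1, hy2, hy⟩ := exists_fixed_point (d := P.natDegree)
    (u := fun i => (u i : HahnSeries ℝ ℂ)) (fun i _ => (u i).2.1)
    (fun i _ => pos_of_residue_eq_zero (hu i))
  let y' : integers := ⟨y, hy1, hy2⟩
  have hy' : y' = 1 + ∑ i ∈ Finset.range P.natDegree, u i * y' ^ (i + 2) :=
    Subtype.ext (by push_cast; exact hy)
  refine ⟨g * y', ?_, by rw [map_mul, hg, zero_mul]⟩
  rw [eval_eq_sum_range' (n := P.natDegree + 2) (by omega), Finset.sum_range_succ',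
    Finset.sum_range_succ']
  have h2 : ∑ i ∈ Finset.range P.natDegree, P.coeff (i + 1 + 1) * (g * y') ^ (i + 1 + 1) =
      -(P.coeff 1 * g) * ∑ i ∈ Finset.range P.natDegree, u i * y' ^ (i + 2) := by
    rw [Finset.mul_sum]
    refine Finset.sum_congr rfl fun i _ => ?_
    simp only [u]
    linear_combination (-P.coeff (i + 2) * (g * y') ^ (i + 2)) * he
  have h3 : ∑ i ∈ Finset.range P.natDegree, u i * y' ^ (i + 2) = y' - 1 := by
    linear_combination -hy'
  rw [h2, h3]
  simp only [g]
  linear_combination (-P.coeff 0) * he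

theorem eval_mul_eq_pow_mul_eval {R : Type*} [CommRing R] {P Q : R[X]} {T : R} {m N : ℕ}
    (hP : P.natDegree < N) (hQ : Q.natDegree < N)
    (h : ∀ i, P.coeff i * T ^ i = T ^ m * Q.coeff i) (s : R) :
    P.eval (T * s) = T ^ m * Q.eval s := by
  rw [eval_eq_sum_range' hP, eval_eq_sum_range' hQ, Finset.mul_sum]
  refine Finset.sum_congr rfl fun i _ => ?_
  rw [mul_pow, ← mul_assoc, h, mul_assoc]

theorem exists_coeff {R : Type*} [Semiring R] (e : ℕ → R) (N : ℕ) (he : ∀ i, N < i → e i = 0) :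
    ∃ P : R[X], P.natDegree ≤ N ∧ ∀ i, P.coeff i = e i := by
  have h : ∀ i, (∑ j ∈ Finset.range (N + 1), monomial j (e j)).coeff i = e i := fun i => by
    simp only [finsetSum_coeff, coeff_monomial, Finset.sum_ite_eq', Finset.mem_range]
    split_ifs with h
    · rfl
    · exact (he i (by omega)).symm
  exact ⟨_, natDegree_le_iff_coeff_eq_zero.2 fun i hi => by rw [h, he i hi], h⟩

/-! ### The Newton–Puiseux induction -/

/-- A complex polynomial of degree `m` without term of degree `m - 1` that is not a monomial has a
root of multiplicity less than `m`. -/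
theorem exists_root_multiplicity_lt {q : ℂ[X]} {m' : ℕ} (hdeg : q.natDegree = m' + 1)
    (h1 : q.coeff m' = 0) {i₀ : ℕ} (hi₀ : i₀ ≤ m') (h2 : q.coeff i₀ ≠ 0) :
    ∃ a j, 0 < j ∧ j < m' + 1 ∧ (∀ i < j, (taylor a q).coeff i = 0) ∧ (taylor a q).coeff j ≠ 0 := by
  have hq : q ≠ 0 := fun h => h2 (by simp [h])
  obtain ⟨a, ha⟩ := IsAlgClosed.exists_root q fun h => by
    rw [degree_eq_natDegree hq, hdeg] at h
    exact absurd h (by norm_cast)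
  have hr : taylor a q ≠ 0 := by simpa using hq
  refine ⟨a, (taylor a q).natTrailingDegree, ?_, ?_,
    fun i hi => coeff_eq_zero_of_lt_natTrailingDegree hi,
    by simpa using trailingCoeff_nonzero_iff_nonzero.2 hr⟩
  · refine Nat.pos_of_ne_zero fun h => ?_
    rw [natTrailingDegree_eq_zero] at h
    refine h.elim hr fun h => h ?_
    rw [taylor_coeff_zero]
    exact ha
  · have hle := natTrailingDegree_le_natDegree (taylor a q)
    rw [natDegree_taylor, hdeg] at hle
    refine lt_of_le_of_ne hle fun heq => ?_
    -- If the multiplicity is the full degree, `q` is a multiple of `(X - a) ^ (m' + 1)`. Its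
    -- coefficient at `m'` is a nonzero multiple of `a`, so `a = 0` and `q` is a monomial, against
    -- `h2`.
    have hmono : taylor a q = C q.leadingCoeff * X ^ (m' + 1) := by
      ext i
      rw [coeff_C_mul, coeff_X_pow]
      rcases lt_trichotomy i (m' + 1) with h | h | h
      · rw [coeff_eq_zero_of_lt_natTrailingDegree (heq ▸ h), if_neg h.ne, mul_zero]
      · have : (taylor a q).leadingCoeff = q.leadingCoeff := by simp
        rw [if_pos h, mul_one, ← this, leadingCoeff, natDegree_taylor, hdeg, h]
      · rw [coeff_eq_zero_of_natDegree_lt (by rwa [natDegree_taylor, hdeg]), if_neg h.ne', mul_zero]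
    have hq' : q = C q.leadingCoeff * (X - C a) ^ (m' + 1) := by
      have := congrArg (taylor (-a)) hmono
      rw [taylor_taylor, neg_add_cancel, taylor_zero, taylor_mul, taylor_C, taylor_X_pow, C_neg,
        ← sub_eq_add_neg] at this
      exact this
    have ha0 : a = 0 := by
      rw [hq', coeff_C_mul, sub_eq_add_neg, ← C_neg, coeff_X_add_C_pow] at h1
      simpa [hq, Nat.cast_add_one_ne_zero] using h1
    rw [hq', ha0, C_0, sub_zero, coeff_C_mul, coeff_X_pow, if_neg (by omega), mul_zero] at h2
    exact h2 rfl

/-- The residue polynomial has `0` as a root of multiplicity `m`. After a shift that kills the term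
of degree `m - 1` and a rescaling by the Newton polygon slope, the new residue polynomial has degree
`m` and is not a power of one linear factor. Some root then has smaller multiplicity, and induction
applies there. -/
theorem exists_root_of_multiplicity (m : ℕ) (hm : 0 < m) (P : integers[X])
    (hlt : ∀ i < m, residue (P.coeff i) = 0) (hPm : residue (P.coeff m) ≠ 0) :
    ∃ s, P.eval s = 0 := by
  classical
  induction m using Nat.strong_induction_on generalizing P with
  | _ m ih =>
  obtain ⟨m', rfl⟩ : ∃ m', m = m' + 1 := ⟨m - 1, by omega⟩
  -- Tschirnhaus shift: the coefficient of degree `m'` of `taylor b P` is `hasseDeriv m' P` at `b`.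
  -- Its zero `b` comes from Hensel's lemma, as the linear coefficient has residue `(m' + 1)` times
  -- that of `P.coeff (m' + 1)`, nonzero in characteristic zero.
  obtain ⟨b, hb, hb0⟩ := exists_root_of_simple (P := hasseDeriv m' P)
    (by rw [hasseDeriv_coeff, map_mul, zero_add, hlt m' (by omega), mul_zero])
    (by
      rw [hasseDeriv_coeff, map_mul, add_comm 1 m', map_natCast]
      refine mul_ne_zero ?_ hPm
      simp [Nat.cast_add_one_ne_zero])
  obtain ⟨R, hR⟩ : ∃ R, R = taylor b P := ⟨_, rfl⟩
  suffices h : ∃ s, R.eval s = 0 by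
    obtain ⟨s, hs⟩ := h
    exact ⟨s + b, by rwa [hR, taylor_eval] at hs⟩
  have hRm' : R.coeff m' = 0 := by rw [hR, taylor_coeff, hb]
  have hres : ∀ i, residue (R.coeff i) = residue (P.coeff i) := fun i => by
    rw [← coeff_map, hR, map_taylor, hb0, taylor_zero, coeff_map]
  -- This also settles multiplicity one, where `m' = 0` and `hRm'` is the only condition.
  by_cases hall : ∀ i < m' + 1, R.coeff i = 0
  · exact ⟨0, by rw [← coeff_zero_eq_eval_zero, hall 0 (by omega)]⟩
  push Not at hall
  obtain ⟨i₁, hi₁, hi₁'⟩ := hall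
  -- The minimum `l` of `ord R_i / (m' + 1 - i)` is the Newton polygon slope: the largest `l` for
  -- which `R(t ^ l X)` is divisible by `t ^ (l (m' + 1))`. The index `i₀` yields a nonzero residue
  -- in the quotient.
  obtain ⟨i₀, hi₀, hmin⟩ := Finset.exists_min_image
    ((Finset.range (m' + 1)).filter fun i => R.coeff i ≠ 0)
    (fun i => (R.coeff i : HahnSeries ℝ ℂ).order / ((m' + 1 - i : ℕ) : ℝ))
    ⟨i₁, Finset.mem_filter.2 ⟨Finset.mem_range.2 hi₁, hi₁'⟩⟩
  rw [Finset.mem_filter, Finset.mem_range] at hi₀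
  obtain ⟨l, hl⟩ : ∃ l, l = (R.coeff i₀ : HahnSeries ℝ ℂ).order / ((m' + 1 - i₀ : ℕ) : ℝ) :=
    ⟨_, rfl⟩
  have hne : ∀ i, R.coeff i ≠ 0 → (R.coeff i : HahnSeries ℝ ℂ) ≠ 0 := fun i h h' =>
    h (Subtype.ext h')
  have hcast : ∀ i < m' + 1, 0 < ((m' + 1 - i : ℕ) : ℝ) := fun i hi => by
    exact_mod_cast Nat.sub_pos_of_lt hi
  have hord : ((m' + 1 - i₀ : ℕ) : ℝ) * l = (R.coeff i₀ : HahnSeries ℝ ℂ).order := by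
    rw [hl, mul_div_cancel₀ _ (hcast i₀ hi₀.1).ne']
  have hl0 : 0 < l := by
    rw [hl]
    refine div_pos (pos_of_residue_eq_zero (by rw [hres, hlt i₀ hi₀.1]) _ ?_) (hcast i₀ hi₀.1)
    exact HahnSeries.coeff_order_eq_zero.not.2 (hne i₀ hi₀.2)
  have hge : ∀ i < m' + 1, OrdGE (((m' + 1 - i : ℕ) : ℝ) * l) (R.coeff i : HahnSeries ℝ ℂ) := by
    intro i hi
    by_cases h : R.coeff i = 0
    · rw [h]
      exact ordGE_zero _
    · refine (ordGE_order _).mono ?_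
      have := hmin i (Finset.mem_filter.2 ⟨Finset.mem_range.2 hi, h⟩)
      rwa [← hl, le_div_iff₀ (hcast i hi), mul_comm] at this
  obtain ⟨T, hT⟩ : ∃ T, T = tpow l hl0.le := ⟨_, rfl⟩
  have hTres : residue T = 0 := by
    rw [hT, residue_apply]
    exact HahnSeries.coeff_single_of_ne hl0.ne
  -- The `e i` are the coefficients of `Q`, where `R(T X) = T ^ (m' + 1) Q(X)`. Above degree `m' +
  -- 1` a positive power of `T` remains, so these residues vanish.
  have hex : ∀ i, ∃ e, R.coeff i * T ^ i = T ^ (m' + 1) * e ∧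
      (i < m' + 1 → residue e = (R.coeff i : HahnSeries ℝ ℂ).coeff (((m' + 1 - i : ℕ) : ℝ) * l)) ∧
      (m' + 1 ≤ i → e = R.coeff i * T ^ (i - (m' + 1))) := fun i => by
    rcases lt_or_ge i (m' + 1) with h | h
    · obtain ⟨e, he1, he2⟩ := exists_eq_tpow_pow_mul hl0.le (m' + 1 - i) (hge i h)
      refine ⟨e, ?_, fun _ => he2, fun h' => absurd h h'.not_gt⟩
      have h3 : T ^ (m' + 1) = T ^ (m' + 1 - i) * T ^ i := by rw [← pow_add]; congr 1; omega
      rw [he1, h3, ← hT]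
      ring
    · refine ⟨_, ?_, fun h' => absurd h' h.not_gt, fun _ => rfl⟩
      have h3 : T ^ i = T ^ (m' + 1) * T ^ (i - (m' + 1)) := by rw [← pow_add]; congr 1; omega
      rw [h3]
      ring
  choose e he1 he2 he3 using hex
  have hmN : m' + 1 ≤ R.natDegree := le_natDegree_of_ne_zero fun h => hPm (by
    rw [← hres, h, map_zero])
  obtain ⟨Q, hQdeg, hQ⟩ := exists_coeff e R.natDegree fun i hi => by
    rw [he3 i (by omega), coeff_eq_zero_of_natDegree_lt hi, zero_mul]
  have hq : ∀ i, (Q.map residue).coeff i = residue (e i) := fun i => by rw [coeff_map, hQ]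
  have hqm : (Q.map residue).coeff (m' + 1) ≠ 0 := by
    rw [hq, he3 _ le_rfl, Nat.sub_self, pow_zero, mul_one, hres]
    exact hPm
  have hqdeg : (Q.map residue).natDegree = m' + 1 := by
    refine le_antisymm (natDegree_le_iff_coeff_eq_zero.2 fun i hi => ?_)
      (le_natDegree_of_ne_zero hqm)
    rw [hq, he3 _ (by omega), map_mul, map_pow, hTres, zero_pow (by omega), mul_zero]
  obtain ⟨a, j, hj0, hj, hj1, hj2⟩ := exists_root_multiplicity_lt hqdeg
    (by rw [hq, he2 m' (by omega), hRm']; rfl) (Nat.lt_succ_iff.1 hi₀.1)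
    (by
      rw [hq, he2 i₀ hi₀.1, hord]
      exact HahnSeries.coeff_order_eq_zero.not.2 (hne i₀ hi₀.2))
  have hmap : ∀ i, residue ((taylor (const a) Q).coeff i) = (taylor a (Q.map residue)).coeff i :=
    fun i => by rw [← coeff_map, map_taylor, residue_const]
  obtain ⟨s, hs⟩ := ih j hj hj0 (taylor (const a) Q) (fun i hi => by rw [hmap, hj1 i hi])
    (by rw [hmap]; exact hj2)
  rw [taylor_eval] at hs
  refine ⟨T * (s + const a), ?_⟩
  rw [eval_mul_eq_pow_mul_eval (Q := Q) (N := R.natDegree + 1) (m := m' + 1) (by omega) (by omega)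
    (fun i => by rw [hQ, he1]) (s + const a), hs, mul_zero]

instance : IsAlgClosed field := IsAlgClosed.of_exists_root _ fun p hp hirr => by
  obtain ⟨n, hn⟩ : ∃ n, n = p.natDegree := ⟨_, rfl⟩
  have hn0 : 0 < n := hn ▸ hirr.natDegree_pos
  let c : ℕ → HahnSeries ℝ ℂ := fun i => (p.coeff i : HahnSeries ℝ ℂ)
  -- For `T = t ^ l` with `l` this large, `T ^ n p(X / T)` is monic and its lower coefficients have
  -- positive exponents. Its residue is `X ^ n`, so `0` is a residue root of multiplicity `n`.
  obtain ⟨l, hl, hlc⟩ : ∃ l : ℝ, 0 < l ∧ ∀ i < n, 0 < l + (c i).order := by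
    refine ⟨1 + ∑ i ∈ Finset.range n, |(c i).order|, ?_, fun i hi => ?_⟩
    · have : 0 ≤ ∑ i ∈ Finset.range n, |(c i).order| := Finset.sum_nonneg fun _ _ => abs_nonneg _
      linarith
    · have := Finset.single_le_sum (f := fun i => |(c i).order|) (fun _ _ => abs_nonneg _)
        (Finset.mem_range.2 hi)
      have := neg_abs_le (c i).order
      linarith
  have hge : ∀ i < n, ∀ τ, (HahnSeries.single ((n - i : ℕ) * l) 1 * c i).coeff τ ≠ 0 → 0 < τ := by
    intro i hi τ hτ
    have h1 := ((ordGE_single ((n - i : ℕ) * l) 1).mul (ordGE_order (c i))) τ hτ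
    have h2 : (1 : ℝ) ≤ (n - i : ℕ) := by exact_mod_cast Nat.sub_pos_of_lt hi
    have := hlc i hi
    nlinarith
  have hex : ∀ i, ∃ e : integers, (i ≤ n → (e : HahnSeries ℝ ℂ) =
      HahnSeries.single ((n - i : ℕ) * l) 1 * c i) ∧ (n < i → e = 0) := fun i => by
    rcases lt_trichotomy i n with h | h | h
    · exact ⟨⟨_, (isConvergent_single _ 1).mul (p.coeff i).2, fun τ hτ => (hge i h τ hτ).le⟩,
        fun _ => rfl, fun h' => absurd h h'.not_gt⟩
    · refine ⟨1, fun _ => ?_, fun h' => absurd h h'.ne'⟩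
      have : c i = 1 := by simp only [c, h, hn, hp.coeff_natDegree]; rfl
      rw [this, h]
      simp
    · exact ⟨0, fun h' => absurd h h'.not_gt, fun _ => rfl⟩
  choose e he1 he2 using hex
  obtain ⟨P, hPdeg, hP⟩ := exists_coeff e n he2
  obtain ⟨s, hs⟩ := exists_root_of_multiplicity n hn0 P
    (fun i hi => by
      by_contra h
      rw [hP, residue_apply, he1 i hi.le] at h
      exact (hge i hi 0 h).false)
    (by
      have : c n = 1 := by simp only [c, hn, hp.coeff_natDegree]; rfl
      rw [hP, residue_apply, he1 n le_rfl, this]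
      simp)
  let S : field := ⟨s, s.2.1⟩
  let T : field := ⟨HahnSeries.single l 1, isConvergent_single l 1⟩
  let T' : field := ⟨HahnSeries.single (-l) 1, isConvergent_single (-l) 1⟩
  have hTT : T * T' = 1 := Subtype.ext (by simp [T, T', HahnSeries.single_mul_single])
  have hT0 : T ≠ 0 := left_ne_zero_of_mul_eq_one hTT
  refine ⟨T' * S, ?_⟩
  have key : T ^ n * p.eval (T' * S) = 0 := by
    rw [eval_eq_sum_range' (n := n + 1) (by omega), Finset.mul_sum]
    rw [eval_eq_sum_range' (n := n + 1) (by omega)] at hs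
    refine Subtype.ext ?_
    have hs' := congrArg (fun b : integers => (b : HahnSeries ℝ ℂ)) hs
    push_cast at hs' ⊢
    rw [← hs']
    refine Finset.sum_congr rfl fun i hi => ?_
    have hi : i ≤ n := Nat.lt_succ_iff.1 (Finset.mem_range.1 hi)
    have h1 : T ^ n * T' ^ i = T ^ (n - i) := by
      have h3 : T ^ n = T ^ (n - i) * T ^ i := by rw [← pow_add]; congr 1; omega
      rw [h3, mul_assoc, ← mul_pow, hTT, one_pow, mul_one]
    have h2 : (T : HahnSeries ℝ ℂ) ^ n * (T' : HahnSeries ℝ ℂ) ^ i =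
        HahnSeries.single ((n - i : ℕ) * l) 1 := by
      have := congrArg (fun b : field => (b : HahnSeries ℝ ℂ)) h1
      push_cast at this
      rw [this]
      simp [T, HahnSeries.single_pow]
    rw [hP, he1 i hi, ← h2]
    simp only [c, S]
    ring
  exact (mul_eq_zero.1 key).resolve_left (pow_ne_zero _ hT0)

/-! ### The valuation on convergent Puiseux series -/

/-- The non-Archimedean valuation `exp ∘ val`. -/
noncomputable def valuation : Valuation field ℝᵐ⁰ where
  toFun b := open Classical in if b = 0 then 0 else WithZero.exp (val b)
  map_zero' := by simp
  map_one' := by simp [val]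
  map_mul' x y := by
    by_cases hx : x = 0
    · simp [hx]
    by_cases hy : y = 0
    · simp [hy]
    have hx' : (x : HahnSeries ℝ ℂ) ≠ 0 := fun h => hx (Subtype.ext h)
    have hy' : (y : HahnSeries ℝ ℂ) ≠ 0 := fun h => hy (Subtype.ext h)
    simp only [hx, hy, mul_ne_zero hx hy, if_false, val, Subfield.coe_mul,
      HahnSeries.order_mul hx' hy', neg_add, WithZero.exp_add]
  map_add_le_max' x y := by
    by_cases hx : x = 0
    · rw [hx, zero_add]
      exact le_max_right _ _
    by_cases hy : y = 0
    · rw [hy, add_zero]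
      exact le_max_left _ _
    by_cases hxy : x + y = 0
    · simp [hxy]
    have hxy' : (x : HahnSeries ℝ ℂ) + y ≠ 0 := fun h => hxy (Subtype.ext h)
    have := HahnSeries.min_order_le_order_add hxy'
    simp only [hx, hy, hxy, if_false, le_max_iff, WithZero.exp_le_exp, val, Subfield.coe_add,
      neg_le_neg_iff]
    exact min_le_iff.1 this

/-- The equality includes `b = 0`, where both sides take the default value `0`; hence the two
functions, and the amoebas formed with them, are equal. -/
theorem log_valuation (b : field) : WithZero.log (valuation b) = val b := by
  change WithZero.log (open Classical in if b = 0 then 0 else WithZero.exp (val b)) = val b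
  split_ifs with h
  · simp [h, val]
  · exact WithZero.log_exp _

theorem valuation_surjective : Function.Surjective valuation := fun r => by
  by_cases hr : r = 0
  · exact ⟨0, by rw [hr, map_zero]⟩
  · have h0 : (HahnSeries.single (-WithZero.log r) 1 : HahnSeries ℝ ℂ) ≠ 0 :=
      HahnSeries.single_ne_zero one_ne_zero
    refine ⟨⟨HahnSeries.single (-WithZero.log r) 1, isConvergent_single _ 1⟩, ?_⟩
    refine (if_neg fun h => h0 (congrArg Subtype.val h)).trans ?_
    rw [val, HahnSeries.order_single one_ne_zero, neg_neg, WithZero.exp_log hr]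

end ConvPuiseux

/-! ### The main theorem -/

theorem mainTheorem5 (k n : ℕ) (hk : 2 ≤ k) (hn : 1 ≤ n)
    (I : Finset (Fin k → ℤ)) (hI : I.card = n + 1) :
    ∃ H : Finset (Module.Dual ℝ (Fin n → Fin k → ℝ)), (∀ l ∈ H, l ≠ 0) ∧
      ∀ x : Fin n → Fin k → ℝ, (∀ l ∈ H, l x ≠ 0) →
        (∃! A : Set (Fin k → ℝ),
          A ∈ NonArchAmoeba.amoebas ConvPuiseux.val I ∧ ∀ i, x i ∈ A) ∧
        ∀ (K : Type*) [Field K] [IsAlgClosed K] (v : Valuation K ℝᵐ⁰), Function.Surjective v →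
          ∃! A : Set (Fin k → ℝ),
            A ∈ NonArchAmoeba.amoebas (fun a => WithZero.log (v a)) I ∧ ∀ i, x i ∈ A := by
  obtain ⟨H, hH, hgen⟩ := Tropical.exists_generic (n := n) I
  refine ⟨H, hH, fun x hx => ⟨?_, fun K _ _ v hv =>
    NonArchAmoeba.existsUnique_amoeba hv hI (hgen x hx)⟩⟩
  have := NonArchAmoeba.existsUnique_amoeba ConvPuiseux.valuation_surjective hI (hgen x hx)
  rwa [funext ConvPuiseux.log_valuation] at this
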